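/- Let $x\in\mathbb{R}^n$ and let $R,C\ge 1$ be integers. The Count-Sketch of $x$ with $R$ rows and $C$ columns uses fully random hash functions: for $u\in[R]$ and $i\in[n]$ the columns $h_u(i)\in[C]$ and the signs $s_u(i)\in\{\pm1\}$ are uniformly distributed and all mutually independent. The sketch is $y_{u,v}=\sum_{i:h_u(i)=v}s_u(i)x_i$, and the estimate $\widehat{x}\in\mathbb{R}^n$ is $\widehat{x}_i=\operatorname{median}_{u\in[R]}\,s_u(i)\,y_{u,h_u(i)}$ (for even $R$ the median is the mean of the two middle values). Write $x_{\mathrm{tail}(k)}$ for the vector obtained from $x$ by replacing its $k$ coordinates of largest absolute value by $0$ (so $x_{\mathrm{tail}(k)}=0$ if $k\ge n$), and $v_S$ for the restriction of a vector $v$ to the coordinates in $S$. Fix constants $t>0$ and $A>0$. There are constants $c_0$ and $K$, depending only on $t$ and $A$, such that the following holds for every real $c\ge c_0$, all integers $n\ge 1$, $k\ge1$, $R\ge1$ with $C=ck$ an integer and $\log k\le A\,R$, every $x\in\mathbb{R}^n$, and every nonempty set $S\subseteq[n]$ with $|S|\le k$: the estimate $\widehat{x}$ of $x$ from Count-Sketch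 with $R$ rows and $C=ck$ columns satisfies \[ \Pr\left[\|\widehat{x}_S-x_S\|_2^2 > t\cdot|S|\cdot\frac1R\cdot\frac{\|x_{\mathrm{tail}(k)}\|_2^2}{k}\right]\le \frac{K}{|S|^{1/14}}. \] -/

import Mathlib

/-- The random choices of a Count-Sketch with `R` rows and `C` columns on `n` coordinates:
`ω u i = (h_u(i), s_u(i))` is the column and the sign assigned to coordinate `i` in row `u`. -/
abbrev SketchHash (R n C : ℕ) : Type := Fin R → Fin n → Fin C × ℤˣ

instance measurableSingletonClass_intUnits : MeasurableSingletonClass ℤˣ where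
  measurableSet_singleton u :=
    ⟨{(u : ℤ)}, MeasurableSet.singleton _, by ext v; simp [Units.ext_iff]⟩

/-- Fully random hash functions: the uniform probability measure on all choices, i.e. all the
columns `h_u(i)` and all the signs `s_u(i)` are uniform and mutually independent. -/
noncomputable def sketchMeasure (R n C : ℕ) : MeasureTheory.Measure (SketchHash R n C) :=
  ProbabilityTheory.uniformOn Set.univ

theorem isProbabilityMeasure_sketchMeasure (R n C : ℕ) (hC : 0 < C) :
    MeasureTheory.IsProbabilityMeasure (sketchMeasure R n C) := by
  have : Nonempty (SketchHash R n C) := ⟨fun _ _ => (⟨0, hC⟩, 1)⟩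
  exact ProbabilityTheory.isProbabilityMeasure_uniformOn Set.finite_univ Set.univ_nonempty

/-- The sketch `y_{u,v} = ∑_{i : h_u(i) = v} s_u(i) x_i`. -/
noncomputable def countSketch {R n C : ℕ} (ω : SketchHash R n C) (x : Fin n → ℝ)
    (u : Fin R) (v : Fin C) : ℝ :=
  ∑ i : Fin n with (ω u i).1 = v, (((ω u i).2 : ℤ) : ℝ) * x i

/-- The median of a finite family of real numbers: the middle order statistic, or the mean of the
two middle ones when the family has even length (and `0` for the empty family). -/
noncomputable def sampleMedian {R : ℕ} (a : Fin R → ℝ) : ℝ :=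
  if hR : 0 < R then
    (a (Tuple.sort a ⟨(R - 1) / 2, by omega⟩) + a (Tuple.sort a ⟨R / 2, by omega⟩)) / 2
  else 0

/-- The Count-Sketch estimate `x̂_i = median_u s_u(i) y_{u,h_u(i)}`. -/
noncomputable def sketchEstimate {R n C : ℕ} (ω : SketchHash R n C) (x : Fin n → ℝ)
    (i : Fin n) : ℝ :=
  sampleMedian fun u : Fin R => (((ω u i).2 : ℤ) : ℝ) * countSketch ω x u (ω u i).1

/-- The number of coordinates that precede `i` when the coordinates of `x` are listed by
decreasing absolute value, ties being broken by the index. -/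
noncomputable def magnitudeRank {n : ℕ} (x : Fin n → ℝ) (i : Fin n) : ℕ :=
  {j : Fin n | |x i| < |x j| ∨ (|x j| = |x i| ∧ j < i)}.ncard

/-- The vector obtained from `x` by replacing its `k` coordinates of largest absolute value
with `0`. -/
noncomputable def tailVec {n : ℕ} (x : Fin n → ℝ) (k : ℕ) (i : Fin n) : ℝ :=
  if magnitudeRank x i < k then 0 else x i

/-! Let `B ^ 2` slightly exceed ‖x_tail‖²/k, let `H` hold the at most k heaviest coordinates, and
put `s ^ 2 = τ * B ^ 2` with τ small. For c large, the light coordinates have energy at most `C * s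
^ 2`. The error of one row at i is symmetric and puts mass at least ε/(32s) on [-ε, ε] for ε ≤ s:
the heavy coordinates all miss the bucket with probability at least 1/2, and the light part is
distributed as the difference of two independent copies of a variable of variance at most s²/2,
which often fall in a common cell of length ε (`le_uprob_abs_bucketSum_le`). Hence the median of R
rows errs by more than ε ≤ s with probability at most 2 exp(-(R/2)(ε/(32s))²), and the typical
squared error is of order s²/R. What remains is to concentrate the sum over S, whose terms are
dependent through shared buckets.

If R⁴ ≤ |S|, truncate each error at B. Rehashing one coordinate in one row affects only its own
error and those of the coordinates in its old and new buckets, so Efron–Stein bounds the variance by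
O(R|S|B⁴) (`variance_truncatedError_le`), and Chebyshev costs O(R³/|S|) = O(|S|^(-1/4)). A union
bound over S removes the truncation: for c large and log k ≤ AR, one error exceeds B with
probability at most 2/k².

If |S| ≤ R⁴, linearize the median: outside rare events the squared error is at most a multiple of
s²/R + (s/R)² G_i², with G_i the sum over rows of the signs of the row errors (`sketchError_sq_le`).
Flipping the sign of i reverses the row error of i and preserves that of j unless they share a
bucket, so the signs have correlation at most 1/C and ∑ G_i² ≤ 2|S|R fails with probability at most
4/|S|. The rare events cost |S| times a quantity exponentially small in √R, which absorbs every
power of |S|.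

For bounded R, k is bounded too and a large K makes the claim trivial. The exponent 1/14 is not
sharp in either regime. -/

open scoped BigOperators

/-- The probability of `s` under the uniform distribution on a finite type. -/
noncomputable def uprob {Ω : Type*} [Fintype Ω] (s : Set Ω) : ℝ :=
  𝔼 ω, s.indicator (fun _ => (1 : ℝ)) ω

/-! ### Elementary probability on finite uniform spaces. -/

section UniformExpectation

variable {Ω : Type*} [Fintype Ω]

theorem uprob_le_expect {s : Set Ω} {f : Ω → ℝ} (h0 : ∀ ω, 0 ≤ f ω) (h1 : ∀ ω ∈ s, 1 ≤ f ω) :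
    uprob s ≤ 𝔼 ω, f ω :=
  Finset.expect_le_expect fun ω _ => Set.indicator_le' h1 (fun ω _ => h0 ω) ω

theorem uprob_mono {s t : Set Ω} (h : s ⊆ t) : uprob s ≤ uprob t :=
  Finset.expect_le_expect fun _ _ =>
    Set.indicator_le_indicator_of_subset h (fun _ => zero_le_one) _

theorem uprob_le_one (s : Set Ω) : uprob s ≤ 1 := by
  rcases isEmpty_or_nonempty Ω with h | h
  · simp [uprob, Finset.univ_eq_empty]
  · calc uprob s ≤ 𝔼 _ω : Ω, (1 : ℝ) := uprob_le_expect (fun _ => zero_le_one) fun _ _ => le_rfl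
      _ = 1 := Fintype.expect_const _

theorem uprob_union_le (s t : Set Ω) : uprob (s ∪ t) ≤ uprob s + uprob t := by
  unfold uprob
  rw [← Finset.expect_add_distrib]
  refine Finset.expect_le_expect fun ω _ => ?_
  by_cases hs : ω ∈ s <;> by_cases ht : ω ∈ t <;> simp [hs, ht]

theorem uprob_biUnion_le {κ : Type*} (T : Finset κ) (s : κ → Set Ω) :
    uprob (⋃ i ∈ T, s i) ≤ ∑ i ∈ T, uprob (s i) := by
  classical
  induction T using Finset.induction_on with
  | empty => simp [uprob]
  | insert a T ha ih =>
    rw [Finset.sum_insert ha, Finset.set_biUnion_insert]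
    exact (uprob_union_le _ _).trans (by gcongr)

theorem uprob_biUnion_le_card_mul {κ : Type*} (T : Finset κ) (s : κ → Set Ω) {b : ℝ}
    (h : ∀ i ∈ T, uprob (s i) ≤ b) : uprob (⋃ i ∈ T, s i) ≤ T.card * b :=
  (uprob_biUnion_le T s).trans ((Finset.sum_le_card_nsmul T _ b h).trans_eq (nsmul_eq_mul _ _))

/-- Markov's inequality. -/
theorem uprob_le_div {s : Set Ω} {f : Ω → ℝ} {b : ℝ} (hb : 0 < b) (h0 : ∀ ω, 0 ≤ f ω)
    (h1 : ∀ ω ∈ s, b ≤ f ω) : uprob s ≤ (𝔼 ω, f ω) / b := by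
  rw [Finset.expect_div]
  exact uprob_le_expect (fun ω => div_nonneg (h0 ω) hb.le) fun ω hω =>
    (one_le_div hb).2 (h1 ω hω)

/-- Jensen's inequality for the square. -/
theorem sq_expect_le [Nonempty Ω] (f : Ω → ℝ) : (𝔼 ω, f ω) ^ 2 ≤ 𝔼 ω, f ω ^ 2 := by
  set e := 𝔼 ω, f ω with he
  have h : 0 ≤ 𝔼 ω, (f ω - e) ^ 2 := Finset.expect_nonneg fun _ _ => sq_nonneg _
  have h2 : 𝔼 ω, (f ω - e) ^ 2 = (𝔼 ω, f ω ^ 2) - e ^ 2 := by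
    have : ∀ ω, (f ω - e) ^ 2 = f ω ^ 2 - (2 * e) * f ω + e ^ 2 := fun ω => by ring
    simp only [this, Finset.expect_add_distrib, Finset.expect_sub_distrib, ← Finset.mul_expect,
      Fintype.expect_const, ← he]
    ring
  linarith

end UniformExpectation

/-! ### Independence: Chernoff bounds and the Efron–Stein inequality. -/

section ProductSpace

variable {ι Ω : Type*} [Fintype ι] [DecidableEq ι] [Fintype Ω]

/-- Resampling one coordinate does not change the uniform distribution. -/
theorem expect_resample [Nonempty Ω] (l : ι) (F : (ι → Ω) → ℝ) :
    𝔼 ω, F ω = 𝔼 ω, 𝔼 a, F (Function.update ω l a) := by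
  have h1 : 𝔼 p : (ι → Ω) × Ω, F p.1 = 𝔼 ω, F ω := by
    rw [← Finset.univ_product_univ, Finset.expect_product]
    simp
  have h2 : 𝔼 p : (ι → Ω) × Ω, F (Function.update p.1 l p.2)
      = 𝔼 ω, 𝔼 a, F (Function.update ω l a) := by
    rw [← Finset.univ_product_univ, Finset.expect_product]
  rw [← h1, ← h2]
  -- Exchanging the coordinate with the fresh value is an involution, hence preserves the uniform
  -- law.
  let e : (ι → Ω) × Ω → (ι → Ω) × Ω := fun p => (Function.update p.1 l p.2, p.1 l)
  have he : Function.Involutive e := fun p => by simp [e]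
  exact (Fintype.expect_equiv he.toPerm _ _ fun p => rfl).symm

theorem expect_apply_coord [Nonempty Ω] (l : ι) (f : Ω → ℝ) :
    𝔼 ω : ι → Ω, f (ω l) = 𝔼 a, f a := by
  rw [expect_resample l]
  simp

theorem expect_prod_coord (f : ι → Ω → ℝ) :
    𝔼 ω : ι → Ω, ∏ u, f u (ω u) = ∏ u, 𝔼 a, f u a := by
  simp only [Fintype.expect_eq_sum_div_card, Finset.prod_div_distrib, Finset.prod_univ_sum,
    Fintype.piFinset_univ, Finset.prod_const, Fintype.card_pi, Finset.card_univ, Nat.cast_pow]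

/-- The exponential Markov inequality for sums of independent copies. -/
theorem uprob_sum_nonneg_le (f : Ω → ℝ) :
    uprob {ω : ι → Ω | 0 ≤ ∑ u, f (ω u)} ≤ (𝔼 a, Real.exp (f a)) ^ Fintype.card ι := by
  calc uprob {ω : ι → Ω | 0 ≤ ∑ u, f (ω u)} ≤ 𝔼 ω : ι → Ω, ∏ u, Real.exp (f (ω u)) := by
        refine uprob_le_expect (fun ω => by positivity) fun ω hω => ?_
        rw [← Real.exp_sum]
        exact Real.one_le_exp hω
    _ = _ := by rw [expect_prod_coord fun _ a => Real.exp (f a)]; simp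

/-- If an event has probability at most `q ≤ 1/2`, it rarely happens in at least half of
independent trials. -/
theorem uprob_majority_le [Nonempty Ω] (s : Set Ω) {q : ℝ} (hq0 : 0 < q) (hq : q ≤ 1 / 2)
    (hs : uprob s ≤ q) :
    uprob {ω : ι → Ω | (Fintype.card ι : ℝ) ≤ 2 * ∑ u, s.indicator (fun _ => (1 : ℝ)) (ω u)}
      ≤ (2 * √(q * (1 - q))) ^ Fintype.card ι := by
  -- The optimal Chernoff tilt: it minimizes q r + (1 - q)/r, with minimum 2√(q(1 - q)).
  set r := √((1 - q) / q) with hr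
  have hq1 : 0 < 1 - q := by linarith
  have hr1 : 1 ≤ r := by
    rw [hr, Real.one_le_sqrt, one_le_div hq0]; linarith
  have hr0 : 0 < r := by linarith
  let f : Ω → ℝ := fun a => Real.log r * (2 * s.indicator (fun _ => (1 : ℝ)) a - 1)
  have hexp : ∀ a, Real.exp (f a) = s.indicator (fun _ => (1 : ℝ)) a * (r - r⁻¹) + r⁻¹ := by
    intro a
    by_cases ha : a ∈ s
    · simp only [f, ha, Set.indicator_of_mem]
      rw [show Real.log r * (2 * 1 - 1) = Real.log r by ring, Real.exp_log hr0]; ring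
    · simp only [f, ha, not_false_eq_true, Set.indicator_of_notMem]
      rw [show Real.log r * (2 * 0 - 1) = -Real.log r by ring, Real.exp_neg, Real.exp_log hr0]
      ring
  have hmgf : 𝔼 a, Real.exp (f a) ≤ 2 * √(q * (1 - q)) := by
    simp only [hexp, Finset.expect_add_distrib, ← Finset.expect_mul, Fintype.expect_const]
    have hinv : r⁻¹ ≤ r := (inv_le_one_of_one_le₀ hr1).trans hr1
    have h1 : uprob s * (r - r⁻¹) + r⁻¹ ≤ q * (r - r⁻¹) + r⁻¹ := by
      have := mul_le_mul_of_nonneg_right hs (sub_nonneg.2 hinv)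
      linarith
    refine h1.trans (le_of_eq ?_)
    have hsq : q * r = √(q * (1 - q)) := by
      rw [hr]
      nth_rewrite 1 [← Real.sqrt_sq hq0.le]
      rw [← Real.sqrt_mul (sq_nonneg q)]
      congr 1
      field_simp
    have hrr : r * r = (1 - q) / q := Real.mul_self_sqrt (by positivity)
    have hinv2 : (1 - q) * r⁻¹ = q * r := by
      field_simp
      rw [pow_two, hrr]; field_simp
    linear_combination hsq + hinv2 + hsq
  refine (uprob_mono ?_).trans ((uprob_sum_nonneg_le f).trans ?_)
  · intro ω hω
    simp only [Set.mem_ofPred_eq, f, ← Finset.mul_sum, Finset.sum_sub_distrib, Finset.sum_const,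
      Finset.card_univ, nsmul_eq_mul, mul_one] at hω ⊢
    exact mul_nonneg (Real.log_nonneg hr1) (by linarith)
  · exact pow_le_pow_left₀ (Finset.expect_nonneg fun _ _ => (Real.exp_pos _).le) hmgf _

/-- Lower tail for a sum of independent copies of a variable with values in `[0, 1]`. -/
theorem uprob_sum_le_quarter_le [Nonempty Ω] (f : Ω → ℝ) (h0 : ∀ a, 0 ≤ f a) (h1 : ∀ a, f a ≤ 1)
    {ν : ℝ} (hν : ν ≤ 𝔼 a, f a) :
    uprob {ω : ι → Ω | ∑ u, f (ω u) ≤ Fintype.card ι * (ν / 4)}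
      ≤ Real.exp (-(Fintype.card ι * (ν / 4))) := by
  have hmgf : 𝔼 a, Real.exp (ν / 4 - f a) ≤ Real.exp (-(ν / 4)) := by
    -- On [0, 1], exp(-y) ≤ 1/(1 + y) ≤ 1 - y/2.
    have hpt : ∀ a, Real.exp (ν / 4 - f a) ≤ Real.exp (ν / 4) * (1 - f a / 2) := by
      intro a
      rw [sub_eq_add_neg, Real.exp_add]
      refine mul_le_mul_of_nonneg_left ?_ (Real.exp_pos _).le
      rw [Real.exp_neg]
      have h := Real.add_one_le_exp (f a)
      have : (Real.exp (f a))⁻¹ ≤ (f a + 1)⁻¹ := inv_anti₀ (by linarith [h0 a]) h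
      refine this.trans ?_
      rw [inv_le_iff_one_le_mul₀ (by linarith [h0 a])]
      nlinarith [h0 a, h1 a, mul_nonneg (h0 a) (sub_nonneg.2 (h1 a))]
    calc 𝔼 a, Real.exp (ν / 4 - f a) ≤ 𝔼 a, Real.exp (ν / 4) * (1 - f a / 2) :=
          Finset.expect_le_expect fun a _ => hpt a
      _ = Real.exp (ν / 4) * (1 - (𝔼 a, f a) / 2) := by
          rw [← Finset.mul_expect, Finset.expect_sub_distrib, Fintype.expect_const,
            Finset.expect_div]
      _ ≤ Real.exp (ν / 4) * Real.exp (-(ν / 2)) := by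
          refine mul_le_mul_of_nonneg_left ?_ (Real.exp_pos _).le
          linarith [Real.add_one_le_exp (-(ν / 2))]
      _ = _ := by rw [← Real.exp_add]; ring_nf
  refine (uprob_mono ?_).trans ((uprob_sum_nonneg_le fun a => ν / 4 - f a).trans ?_)
  · intro ω hω
    simp only [Set.mem_ofPred_eq, Finset.sum_sub_distrib, Finset.sum_const, Finset.card_univ,
      nsmul_eq_mul] at hω ⊢
    linarith
  · refine (pow_le_pow_left₀ (Finset.expect_nonneg fun _ _ => (Real.exp_pos _).le) hmgf _).trans
      (le_of_eq ?_)
    rw [← Real.exp_nat_mul]; ring_nf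

/-- The average of `f` over the coordinates in `T`. -/
noncomputable def expectOver (T : Finset ι) (f : (ι → Ω) → ℝ) (ω : ι → Ω) : ℝ :=
  𝔼 ω' : ι → Ω, f (T.piecewise ω' ω)

theorem expectOver_insert [Nonempty Ω] (T : Finset ι) {l : ι} (hl : l ∉ T) (f : (ι → Ω) → ℝ)
    (ω : ι → Ω) :
    expectOver (insert l T) f ω = 𝔼 a, expectOver T f (Function.update ω l a) := by
  unfold expectOver
  rw [expect_resample l, Finset.expect_comm]
  refine Finset.expect_congr rfl fun a _ => Finset.expect_congr rfl fun ω' _ => ?_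
  congr 1
  ext j
  by_cases hj : j = l
  · subst hj; simp [hl]
  · by_cases hT : j ∈ T <;> simp [hj, hT, Finset.piecewise]

/-- With A the average over coordinate l, split the deviation as (f - A f) + A (f - E_T f). The
second term does not depend on l and the first averages to zero over l, so they are orthogonal.
Jensen bounds the first by the resampling term and shows that A contracts the second to the
inductive case. -/
theorem sq_expect_sub_le [Nonempty Ω] (T : Finset ι) (f : (ι → Ω) → ℝ) :
    𝔼 ω, (f ω - expectOver T f ω) ^ 2
      ≤ ∑ l ∈ T, 𝔼 ω, 𝔼 a, (f ω - f (Function.update ω l a)) ^ 2 := by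
  induction T using Finset.induction_on with
  | empty => simp [expectOver]
  | insert l T hl ih =>
    rw [Finset.sum_insert hl]
    set A : ((ι → Ω) → ℝ) → (ι → Ω) → ℝ := fun g ω => 𝔼 a, g (Function.update ω l a) with hA
    have hAupd : ∀ g ω a, A g (Function.update ω l a) = A g ω := by
      intro g ω a; simp [hA]
    set d := fun ω => f ω - expectOver T f ω with hd
    have hAd : ∀ ω, f ω - expectOver (insert l T) f ω = (f ω - A f ω) + A d ω := by
      intro ω
      rw [expectOver_insert T hl]
      simp only [hA, hd, Finset.expect_sub_distrib]
      ring
    have hcross : 𝔼 ω, (f ω - A f ω) * A d ω = 0 := by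
      rw [expect_resample l]
      refine Finset.expect_eq_zero fun ω _ => ?_
      simp only [hAupd, ← Finset.expect_mul, Finset.expect_sub_distrib, Fintype.expect_const]
      simp [hA]
    have hexp : ∀ ω, (f ω - expectOver (insert l T) f ω) ^ 2
        = (f ω - A f ω) ^ 2 + 2 * ((f ω - A f ω) * A d ω) + A d ω ^ 2 := by
      intro ω; rw [hAd]; ring
    simp only [hexp, Finset.expect_add_distrib, ← Finset.mul_expect, hcross]
    have h1 : 𝔼 ω, (f ω - A f ω) ^ 2 ≤ 𝔼 ω, 𝔼 a, (f ω - f (Function.update ω l a)) ^ 2 := by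
      refine Finset.expect_le_expect fun ω _ => ?_
      have := sq_expect_le fun a => f ω - f (Function.update ω l a)
      rwa [Finset.expect_sub_distrib, Fintype.expect_const] at this
    have h2 : 𝔼 ω, A d ω ^ 2 ≤ 𝔼 ω, d ω ^ 2 := by
      rw [expect_resample l fun ω => d ω ^ 2]
      exact Finset.expect_le_expect fun ω _ => sq_expect_le _
    have h3 : 𝔼 ω, d ω ^ 2 ≤ ∑ l ∈ T, 𝔼 ω, 𝔼 a, (f ω - f (Function.update ω l a)) ^ 2 := ih
    linarith

/-- The Efron–Stein inequality (up to a factor `2`). -/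
theorem efron_stein [Nonempty Ω] (f : (ι → Ω) → ℝ) :
    𝔼 ω, (f ω - 𝔼 ω', f ω') ^ 2
      ≤ ∑ l, 𝔼 ω, 𝔼 a, (f ω - f (Function.update ω l a)) ^ 2 := by
  have := sq_expect_sub_le Finset.univ f
  simpa [expectOver] using this

end ProductSpace

/-! ### Medians: majorities and stability. -/

section Median

variable {R : ℕ}

/-- Even when the median is a mean of two middle values, the upper one exceeds `z`, and so do all
order statistics from position `R / 2` on, which are at least half. -/
theorem le_two_mul_sum_of_lt_sampleMedian (a : Fin R → ℝ) {z : ℝ} (hR : 0 < R)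
    (h : z < sampleMedian a) :
    (R : ℝ) ≤ 2 * ∑ u, {y : ℝ | z < y}.indicator (fun _ => (1 : ℝ)) (a u) := by
  have hm := Tuple.monotone_sort a
  rw [sampleMedian, dif_pos hR] at h
  have hle : a (Tuple.sort a ⟨(R - 1) / 2, by omega⟩) ≤ a (Tuple.sort a ⟨R / 2, by omega⟩) :=
    hm (show (⟨(R - 1) / 2, by omega⟩ : Fin R) ≤ ⟨R / 2, by omega⟩ from by
      simp only [Fin.mk_le_mk]; omega)
  have hz : z < a (Tuple.sort a ⟨R / 2, by omega⟩) := by linarith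
  have hcard : (((Finset.Ici (⟨R / 2, by omega⟩ : Fin R)).card : ℕ) : ℝ)
      ≤ ∑ u, {y : ℝ | z < y}.indicator (fun _ => (1 : ℝ)) (a u) := by
    rw [← Equiv.sum_comp (Tuple.sort a), Finset.card_eq_sum_ones, Nat.cast_sum]
    refine (Finset.sum_le_sum fun v hv => ?_).trans (Finset.sum_le_sum_of_subset_of_nonneg
      (Finset.subset_univ _) fun v _ _ => Set.indicator_nonneg (fun _ _ => zero_le_one) _)
    have : z < a (Tuple.sort a v) := hz.trans_le (hm (Finset.mem_Ici.1 hv))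
    simp [this]
  rw [Fin.card_Ici] at hcard
  have : (R : ℝ) ≤ 2 * ((R - R / 2 : ℕ) : ℝ) := by exact_mod_cast (by omega)
  linarith

theorem le_two_mul_sum_of_sampleMedian_lt (a : Fin R → ℝ) {z : ℝ} (hR : 0 < R)
    (h : sampleMedian a < z) :
    (R : ℝ) ≤ 2 * ∑ u, {y : ℝ | y < z}.indicator (fun _ => (1 : ℝ)) (a u) := by
  have hm := Tuple.monotone_sort a
  rw [sampleMedian, dif_pos hR] at h
  have hle : a (Tuple.sort a ⟨(R - 1) / 2, by omega⟩) ≤ a (Tuple.sort a ⟨R / 2, by omega⟩) :=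
    hm (show (⟨(R - 1) / 2, by omega⟩ : Fin R) ≤ ⟨R / 2, by omega⟩ from by
      simp only [Fin.mk_le_mk]; omega)
  have hz : a (Tuple.sort a ⟨(R - 1) / 2, by omega⟩) < z := by linarith
  have hcard : (((Finset.Iic (⟨(R - 1) / 2, by omega⟩ : Fin R)).card : ℕ) : ℝ)
      ≤ ∑ u, {y : ℝ | y < z}.indicator (fun _ => (1 : ℝ)) (a u) := by
    rw [← Equiv.sum_comp (Tuple.sort a), Finset.card_eq_sum_ones, Nat.cast_sum]
    refine (Finset.sum_le_sum fun v hv => ?_).trans (Finset.sum_le_sum_of_subset_of_nonneg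
      (Finset.subset_univ _) fun v _ _ => Set.indicator_nonneg (fun _ _ => zero_le_one) _)
    have : a (Tuple.sort a v) < z := (hm (Finset.mem_Iic.1 hv)).trans_lt hz
    simp [this]
  rw [Fin.card_Iic] at hcard
  have : (R : ℝ) ≤ 2 * (((R - 1) / 2 + 1 : ℕ) : ℝ) := by exact_mod_cast (by omega)
  linarith

/-- Pigeonhole: the `k + 1` smallest values of `b` and the `R - k` largest of `a` are taken at a
common index. -/
theorem apply_sort_le_add (a b : Fin R → ℝ) {δ : ℝ} (h : ∀ u, a u ≤ b u + δ) (k : Fin R) :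
    a (Tuple.sort a k) ≤ b (Tuple.sort b k) + δ := by
  classical
  have hcard : Fintype.card (Fin R) < ((Finset.Iic k).image (Tuple.sort b)).card
      + ((Finset.Ici k).image (Tuple.sort a)).card := by
    rw [Finset.card_image_of_injective _ (Tuple.sort b).injective,
      Finset.card_image_of_injective _ (Tuple.sort a).injective, Fin.card_Iic, Fin.card_Ici,
      Fintype.card_fin]
    omega
  obtain ⟨u, hu⟩ := Finset.inter_nonempty_of_card_lt_card_add_card
    (Finset.subset_univ _) (Finset.subset_univ _) hcard
  simp only [Finset.mem_inter, Finset.mem_image, Finset.mem_Iic, Finset.mem_Ici] at hu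
  obtain ⟨⟨v, hv, hvu⟩, w, hw, hwu⟩ := hu
  have h1 := Tuple.monotone_sort a hw
  have h2 := Tuple.monotone_sort b hv
  simp only [Function.comp_apply, hvu, hwu] at h1 h2
  linarith [h u]

theorem sampleMedian_le_add (a b : Fin R → ℝ) {δ : ℝ} (hδ : 0 ≤ δ) (h : ∀ u, a u ≤ b u + δ) :
    sampleMedian a ≤ sampleMedian b + δ := by
  unfold sampleMedian
  split_ifs with hR
  · linarith [apply_sort_le_add a b h ⟨(R - 1) / 2, by omega⟩,
      apply_sort_le_add a b h ⟨R / 2, by omega⟩]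
  · simpa using hδ

theorem abs_sampleMedian_sub_le (a b : Fin R → ℝ) {δ : ℝ} (hδ : 0 ≤ δ)
    (h : ∀ u, |a u - b u| ≤ δ) : |sampleMedian a - sampleMedian b| ≤ δ := by
  rw [abs_sub_le_iff]
  constructor
  · linarith [sampleMedian_le_add a b hδ fun u => by linarith [(abs_sub_le_iff.1 (h u)).1]]
  · linarith [sampleMedian_le_add b a hδ fun u => by linarith [(abs_sub_le_iff.1 (h u)).2]]

end Median

/-! ### The law of the error in a single row. -/

section RowLaw

variable {n C : ℕ}

/-- The signed contribution of the coordinates in `T` to the bucket `a.1`, multiplied by the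
sign `a.2`. -/
noncomputable def bucketSum (x : Fin n → ℝ) (T : Finset (Fin n)) (a : Fin C × ℤˣ)
    (ρ : Fin n → Fin C × ℤˣ) : ℝ :=
  ∑ j ∈ T, if (ρ j).1 = a.1 then (((a.2 : ℤ) : ℝ) * (((ρ j).2 : ℤ) : ℝ)) * x j else 0

/-- The error of the estimate of `x i` from a single row. -/
noncomputable def rowNoise (x : Fin n → ℝ) (i : Fin n) (ρ : Fin n → Fin C × ℤˣ) : ℝ :=
  bucketSum x (Finset.univ.erase i) (ρ i) ρ

theorem bucketSum_update_of_notMem (x : Fin n → ℝ) {T : Finset (Fin n)} {l : Fin n} (hl : l ∉ T)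
    (a b : Fin C × ℤˣ) (ρ : Fin n → Fin C × ℤˣ) :
    bucketSum x T a (Function.update ρ l b) = bucketSum x T a ρ := by
  refine Finset.sum_congr rfl fun j hj => ?_
  rw [Function.update_of_ne (ne_of_mem_of_not_mem hj hl)]

theorem expect_hash_contribution [NeZero C] (f : ℝ → ℝ) (z y : ℝ) (a : Fin C × ℤˣ) :
    𝔼 b : Fin C × ℤˣ,
        f ((if b.1 = a.1 then (((a.2 : ℤ) : ℝ) * ((b.2 : ℤ) : ℝ)) * y else 0) + z)
      = (1 - 1 / C) * f z + 1 / (2 * C) * (f (z + y) + f (z - y)) := by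
  have hC : (C : ℝ) ≠ 0 := Nat.cast_ne_zero.2 (NeZero.ne C)
  have h2 : ∀ v : Fin C, ∑ s : ℤˣ,
      f ((if v = a.1 then (((a.2 : ℤ) : ℝ) * ((s : ℤ) : ℝ)) * y else 0) + z)
      = (if v = a.1 then f (z + y) + f (z - y) - 2 * f z else 0) + 2 * f z := by
    intro v
    rw [UnitsInt.univ, Finset.sum_pair (by decide)]
    split_ifs with h
    · rcases Int.units_eq_one_or a.2 with h | h <;> rw [h] <;> push_cast <;> ring_nf
    · simp; ring
  rw [Fintype.expect_eq_sum_div_card, ← Finset.univ_product_univ, Finset.sum_product]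
  simp only [h2, Finset.sum_add_distrib, Finset.sum_ite_eq', Finset.mem_univ, if_true,
    Finset.sum_const, Finset.card_univ, Fintype.card_fin, nsmul_eq_mul, Fintype.card_prod,
    Fintype.card_units_int, Nat.cast_mul, Nat.cast_ofNat]
  field_simp
  ring

/-- A new coordinate misses the bucket or adds ±x_l with probability 1/(2C) each. This recursion
drives the inductions for the second moment, the avoidance of heavy coordinates and the
symmetrization. -/
theorem expect_bucketSum_insert [NeZero C] (x : Fin n → ℝ) {T : Finset (Fin n)} {l : Fin n}
    (hl : l ∉ T) (a : Fin C × ℤˣ) (f : ℝ → ℝ) :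
    𝔼 ρ, f (bucketSum x (insert l T) a ρ)
      = 𝔼 ρ, ((1 - 1 / C) * f (bucketSum x T a ρ)
        + 1 / (2 * C) * (f (bucketSum x T a ρ + x l) + f (bucketSum x T a ρ - x l))) := by
  rw [expect_resample l]
  refine Finset.expect_congr rfl fun ρ _ => ?_
  rw [← expect_hash_contribution f _ _ a]
  refine Finset.expect_congr rfl fun b _ => ?_
  rw [← bucketSum_update_of_notMem x hl a b ρ, bucketSum, Finset.sum_insert hl,
    Function.update_self, bucketSum]

theorem expect_bucketSum_sq [NeZero C] (x : Fin n → ℝ) (T : Finset (Fin n)) (a : Fin C × ℤˣ) :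
    𝔼 ρ, bucketSum x T a ρ ^ 2 = (∑ j ∈ T, x j ^ 2) / C := by
  have hC : (C : ℝ) ≠ 0 := Nat.cast_ne_zero.2 (NeZero.ne C)
  induction T using Finset.induction_on with
  | empty => simp [bucketSum]
  | insert l T hl ih =>
    rw [expect_bucketSum_insert x hl a (fun z => z ^ 2), Finset.sum_insert hl, add_div, ← ih]
    have : ∀ ρ, (1 - 1 / (C : ℝ)) * bucketSum x T a ρ ^ 2
        + 1 / (2 * C) * ((bucketSum x T a ρ + x l) ^ 2 + (bucketSum x T a ρ - x l) ^ 2)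
        = x l ^ 2 / C + bucketSum x T a ρ ^ 2 := by
      intro ρ; field_simp; ring
    simp only [this, Finset.expect_add_distrib, Fintype.expect_const]

/-- Keep only the event that every coordinate of `H` misses the bucket; nonnegativity of `f`
discards the rest. -/
theorem expect_bucketSum_union_ge [NeZero C] (x : Fin n → ℝ) (T H : Finset (Fin n))
    (hd : Disjoint H T) (a : Fin C × ℤˣ) (f : ℝ → ℝ) (hf : ∀ z, 0 ≤ f z) :
    (1 - 1 / (C : ℝ)) ^ H.card * 𝔼 ρ, f (bucketSum x T a ρ)
      ≤ 𝔼 ρ, f (bucketSum x (H ∪ T) a ρ) := by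
  have hC : (1 : ℝ) ≤ C := Nat.one_le_cast.2 (NeZero.one_le)
  have h1C : 0 ≤ 1 - 1 / (C : ℝ) := sub_nonneg.2 ((div_le_one (by linarith)).2 hC)
  induction H using Finset.induction_on with
  | empty => simp
  | insert l H hl ih =>
    rw [Finset.disjoint_insert_left] at hd
    have hlT : l ∉ H ∪ T := by simp [hl, hd.1]
    rw [Finset.insert_union, expect_bucketSum_insert x hlT, Finset.card_insert_of_notMem hl,
      pow_succ', mul_assoc]
    refine (mul_le_mul_of_nonneg_left (ih hd.2) h1C).trans ?_
    rw [Finset.mul_expect]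
    refine Finset.expect_le_expect fun ρ _ => ?_
    have := add_nonneg (hf (bucketSum x (H ∪ T) a ρ + x l)) (hf (bucketSum x (H ∪ T) a ρ - x l))
    have := mul_nonneg (show 0 ≤ 1 / (2 * (C : ℝ)) by positivity) this
    linarith

/-- A bucket sum has the law of the difference of two independent copies of a centred variable. -/
theorem exists_symmetrization [NeZero C] (hC2 : 2 ≤ C) (x : Fin n → ℝ) (T : Finset (Fin n))
    (a : Fin C × ℤˣ) :
    ∃ (κ : Type) (_ : Fintype κ) (w y : κ → ℝ), (∀ p, 0 ≤ w p) ∧ ∑ p, w p = 1 ∧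
      ∑ p, w p * y p = 0 ∧ ∑ p, w p * y p ^ 2 = (∑ j ∈ T, x j ^ 2) / (2 * C) ∧
      ∀ f : ℝ → ℝ, 𝔼 ρ, f (bucketSum x T a ρ) = ∑ p, ∑ q, w p * w q * f (y p - y q) := by
  have hC : (2 : ℝ) ≤ C := by exact_mod_cast hC2
  -- A two-point variable equal to (1 - β)x_l with probability β and to -βx_l otherwise is centred,
  -- and the difference of two copies is ±x_l with probability β(1 - β) each. Matching this with
  -- 1/(2C) needs a real root, hence C ≥ 2.
  obtain ⟨β, hβ0, hβ1, hβ⟩ : ∃ β : ℝ, 0 ≤ β ∧ β ≤ 1 ∧ β * (1 - β) = 1 / (2 * C) := by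
    have h0 : 0 ≤ 1 - 2 / (C : ℝ) := sub_nonneg.2 ((div_le_one (by linarith)).2 hC)
    have h1 : √(1 - 2 / (C : ℝ)) ≤ 1 := by
      rw [Real.sqrt_le_one]; linarith [show 0 ≤ 2 / (C : ℝ) by positivity]
    have h2 := Real.sqrt_nonneg (1 - 2 / (C : ℝ))
    refine ⟨(1 - √(1 - 2 / (C : ℝ))) / 2, by linarith, by linarith, ?_⟩
    have h3 := Real.mul_self_sqrt h0
    have h4 : 2 / (C : ℝ) = 4 * (1 / (2 * C)) := by field_simp; norm_num
    linear_combination (-1 / 4) * h3 + (1 / 4) * h4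
  induction T using Finset.induction_on with
  | empty =>
    exact ⟨Unit, inferInstance, fun _ => 1, fun _ => 0, by simp [bucketSum]⟩
  | insert l T hl ih =>
    obtain ⟨κ, _, w, y, hw, hw1, hy, hy2, hf⟩ := ih
    let v : Bool → ℝ := fun b => cond b β (1 - β)
    let e : Bool → ℝ := fun b => cond b ((1 - β) * x l) (-(β * x l))
    refine ⟨κ × Bool, inferInstance, fun p => w p.1 * v p.2, fun p => y p.1 + e p.2,
      ?_, ?_, ?_, ?_, fun f => ?_⟩
    · rintro ⟨p, b⟩
      exact mul_nonneg (hw p) (by cases b <;> simp only [v, cond] <;> linarith)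
    · rw [Fintype.sum_prod_type, ← hw1]
      refine Finset.sum_congr rfl fun p _ => ?_
      simp only [Fintype.sum_bool, v, cond]; ring
    · rw [Fintype.sum_prod_type, ← hy]
      refine Finset.sum_congr rfl fun p _ => ?_
      simp only [Fintype.sum_bool, v, e, cond]; ring
    · rw [Fintype.sum_prod_type, Finset.sum_insert hl, add_div, ← hy2]
      have : ∀ p, ∑ b, w p * v b * (y p + e b) ^ 2
          = w p * (x l ^ 2 / (2 * C)) + w p * y p ^ 2 := by
        intro p
        simp only [Fintype.sum_bool, v, e, cond]
        linear_combination (w p * x l ^ 2) * hβ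
      simp only [this, Finset.sum_add_distrib, ← Finset.sum_mul, hw1, one_mul]
    · rw [expect_bucketSum_insert x hl, hf fun z => (1 - 1 / (C : ℝ)) * f z
        + 1 / (2 * C) * (f (z + x l) + f (z - x l)), Fintype.sum_prod_type]
      refine Finset.sum_congr rfl fun p _ => ?_
      simp only [Fintype.sum_prod_type, Fintype.sum_bool, v, e, cond]
      rw [← Finset.sum_add_distrib]
      refine Finset.sum_congr rfl fun q _ => ?_
      have h1 : y p + (1 - β) * x l - (y q + (1 - β) * x l) = y p - y q := by ring
      have h2 : y p + -(β * x l) - (y q + -(β * x l)) = y p - y q := by ring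
      have h3 : y p + (1 - β) * x l - (y q + -(β * x l)) = y p - y q + x l := by ring
      have h4 : y p + -(β * x l) - (y q + (1 - β) * x l) = y p - y q - x l := by ring
      rw [h1, h2, h3, h4]
      have h5 : 1 / (C : ℝ) = 2 * (1 / (2 * C)) := by field_simp
      rw [h5, ← hβ]
      ring

/-- Two independent copies of a variable of variance at most `s ^ 2 / 2` are within `ε` of each
other with probability at least `ε / (16 * s)`. -/
theorem sum_close_pairs_ge {κ : Type*} [Fintype κ] (w y : κ → ℝ) (hw : ∀ p, 0 ≤ w p)
    (hw1 : ∑ p, w p = 1) {s ε : ℝ} (hε : 0 < ε) (hεs : ε ≤ s)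
    (hy : ∑ p, w p * y p ^ 2 ≤ s ^ 2 / 2) :
    ε / (16 * s) ≤ ∑ p, ∑ q,
      w p * w q * {z : ℝ | |z| ≤ ε}.indicator (fun _ => (1 : ℝ)) (y p - y q) := by
  have hs : 0 < s := hε.trans_le hεs
  set M : ℤ := ⌊s / ε⌋ with hM
  have hM0 : 0 ≤ M := Int.floor_nonneg.2 (by positivity)
  have hM' : (M : ℝ) ≤ s / ε := Int.floor_le _
  -- Cut the line into cells of length ε. Two values in one cell are ε-close, and at most 4s/ε cells
  -- are needed to cover [-s, s].
  set c : κ → ℤ := fun p => ⌊y p / ε⌋ with hc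
  let I : Finset ℤ := Finset.Icc (-M - 1) M
  let W : ℤ → ℝ := fun v => ∑ p, w p * (if c p = v then 1 else 0)
  have hIcard : (I.card : ℝ) ≤ 4 * (s / ε) := by
    have h1 : (I.card : ℤ) = 2 * M + 2 := by
      simp only [I, Int.card_Icc]; omega
    have h2 : (I.card : ℝ) = 2 * M + 2 := by exact_mod_cast h1
    have h3 : 1 ≤ s / ε := (one_le_div hε).2 hεs
    linarith
  have hin : ∀ p, |y p| ≤ s → c p ∈ I := by
    intro p hp
    rw [abs_le] at hp
    simp only [I, Finset.mem_Icc, hc]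
    constructor
    · rw [Int.le_floor]
      have h1 : s / ε < M + 1 := Int.lt_floor_add_one _
      have h2 : -(s / ε) ≤ y p / ε := by rw [← neg_div]; gcongr; exact hp.1
      push_cast; linarith
    · exact Int.floor_le_floor (by gcongr; exact hp.2)
  -- Chebyshev: at least half of the mass lies in [-s, s]. Cauchy–Schwarz over the cells then bounds
  -- the probability of a shared cell below.
  have hhalf : 1 / 2 ≤ ∑ v ∈ I, W v := by
    have h1 : ∑ v ∈ I, W v = ∑ p, w p * (if c p ∈ I then 1 else 0) := by
      simp only [W]
      rw [Finset.sum_comm]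
      refine Finset.sum_congr rfl fun p _ => ?_
      rw [← Finset.mul_sum, Finset.sum_ite_eq]
    have h2 : ∀ p, w p - w p * y p ^ 2 / s ^ 2 ≤ w p * (if c p ∈ I then 1 else 0) := by
      intro p
      split_ifs with h
      · have : 0 ≤ w p * y p ^ 2 / s ^ 2 := div_nonneg (mul_nonneg (hw p) (sq_nonneg _)) (sq_nonneg _)
        linarith
      · have h3 : s < |y p| := by
          by_contra h4
          exact h (hin p (not_lt.1 h4))
        have h5 : s ^ 2 ≤ y p ^ 2 := by
          rw [← sq_abs (y p)]; exact pow_le_pow_left₀ hs.le h3.le 2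
        have h6 : w p ≤ w p * y p ^ 2 / s ^ 2 := by
          rw [le_div_iff₀ (by positivity)]
          exact mul_le_mul_of_nonneg_left h5 (hw p)
        linarith
    have h3 := Finset.sum_le_sum fun p (_ : p ∈ Finset.univ) => h2 p
    rw [Finset.sum_sub_distrib, hw1, ← Finset.sum_div] at h3
    have h4 : (∑ p, w p * y p ^ 2) / s ^ 2 ≤ 1 / 2 := by
      rw [div_le_iff₀ (by positivity)]; linarith
    rw [h1]; linarith
  have hCS : (∑ v ∈ I, W v) ^ 2 ≤ I.card * ∑ v ∈ I, W v ^ 2 := sq_sum_le_card_mul_sum_sq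
  have hpair : ∑ v ∈ I, W v ^ 2
      ≤ ∑ p, ∑ q, w p * w q * {z : ℝ | |z| ≤ ε}.indicator (fun _ => (1 : ℝ)) (y p - y q) := by
    have h1 : ∑ v ∈ I, W v ^ 2 = ∑ p, ∑ q, w p * w q *
        ∑ v ∈ I, (if c p = v then (1 : ℝ) else 0) * (if c q = v then 1 else 0) := by
      have hW : ∀ v, W v ^ 2 = ∑ p, ∑ q, w p * w q *
          ((if c p = v then (1 : ℝ) else 0) * (if c q = v then 1 else 0)) := by
        intro v
        simp only [W]
        rw [pow_two, Finset.sum_mul_sum]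
        exact Finset.sum_congr rfl fun p _ => Finset.sum_congr rfl fun q _ => by ring
      simp only [hW, Finset.mul_sum]
      rw [Finset.sum_comm]
      exact Finset.sum_congr rfl fun p _ => Finset.sum_comm
    rw [h1]
    refine Finset.sum_le_sum fun p _ => Finset.sum_le_sum fun q _ =>
      mul_le_mul_of_nonneg_left ?_ (mul_nonneg (hw p) (hw q))
    by_cases hcc : c p = c q
    · have hmem : |y p - y q| ≤ ε := by
        have h3 : |y p / ε - y q / ε| < 1 := Int.abs_sub_lt_one_of_floor_eq_floor hcc
        rw [← sub_div, abs_div, abs_of_pos hε, div_lt_one hε] at h3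
        exact h3.le
      rw [Set.indicator_of_mem (show y p - y q ∈ {z : ℝ | |z| ≤ ε} from hmem)]
      simp only [ite_mul, one_mul, zero_mul, Finset.sum_ite_eq, hcc]
      split_ifs <;> norm_num
    · refine (le_of_eq (Finset.sum_eq_zero fun v _ => ?_)).trans
        (Set.indicator_nonneg (fun _ _ => zero_le_one) _)
      by_cases h1 : c p = v
      · simp [h1, show c q ≠ v from fun h => hcc (h1.trans h.symm)]
      · simp [h1]
  have h5 : (1 / 2 : ℝ) ^ 2 ≤ (∑ v ∈ I, W v) ^ 2 := pow_le_pow_left₀ (by norm_num) hhalf 2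
  have h6 : 0 ≤ ∑ v ∈ I, W v ^ 2 := Finset.sum_nonneg fun _ _ => sq_nonneg _
  have h7 : (1 / 4 : ℝ) ≤ 4 * (s / ε) * ∑ v ∈ I, W v ^ 2 := by
    have := mul_le_mul_of_nonneg_right hIcard h6
    linarith
  refine le_trans ?_ hpair
  rw [div_le_iff₀ (by positivity)]
  have h8 : 4 * (s / ε) * (∑ v ∈ I, W v ^ 2) * ε = 4 * s * ∑ v ∈ I, W v ^ 2 := by
    field_simp
  have := mul_le_mul_of_nonneg_right h7 hε.le
  rw [h8] at this
  linarith

/-- Small ball estimate for bucket sums. -/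
theorem le_uprob_abs_bucketSum_le [NeZero C] (hC2 : 2 ≤ C) (x : Fin n → ℝ)
    (H T : Finset (Fin n)) (a : Fin C × ℤˣ) (hH : 2 * H.card ≤ C) {s ε : ℝ} (hε : 0 < ε)
    (hεs : ε ≤ s) (hx : ∑ j ∈ Hᶜ, x j ^ 2 ≤ C * s ^ 2) :
    ε / (32 * s) ≤ uprob {ρ | |bucketSum x T a ρ| ≤ ε} := by
  have hC : (2 : ℝ) ≤ C := by exact_mod_cast hC2
  have hs : 0 < s := hε.trans_le hεs
  obtain ⟨κ, _, w, y, hw, hw1, -, hy2, hf⟩ := exists_symmetrization hC2 x (T \ H) a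
  set φ : ℝ → ℝ := {z : ℝ | |z| ≤ ε}.indicator (fun _ => (1 : ℝ)) with hφ
  have hvar : ∑ p, w p * y p ^ 2 ≤ s ^ 2 / 2 := by
    rw [hy2, div_le_iff₀ (by positivity)]
    have : ∑ j ∈ T \ H, x j ^ 2 ≤ ∑ j ∈ Hᶜ, x j ^ 2 :=
      Finset.sum_le_sum_of_subset_of_nonneg (fun j hj => by simp at hj ⊢; exact hj.2)
        fun _ _ _ => sq_nonneg _
    linarith
  have h1 := sum_close_pairs_ge w y hw hw1 hε hεs hvar
  rw [← hφ, ← hf] at h1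
  have h2 := expect_bucketSum_union_ge x (T \ H) (T ∩ H) (Finset.disjoint_sdiff_inter T H).symm a φ
    (fun z => Set.indicator_nonneg (fun _ _ => zero_le_one) _)
  rw [show T ∩ H ∪ T \ H = T by ext j; simp; tauto] at h2
  -- Bernoulli's inequality with |H| ≤ C/2.
  have h3 : 1 / 2 ≤ (1 - 1 / (C : ℝ)) ^ (T ∩ H).card := by
    have h4 : 1 / (C : ℝ) ≤ 1 := (div_le_one (by linarith)).2 (by linarith)
    have h5 := one_add_mul_le_pow (show (-2 : ℝ) ≤ -(1 / (C : ℝ)) by linarith) (T ∩ H).card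
    have h6 : ((T ∩ H).card : ℝ) ≤ H.card := by
      exact_mod_cast Finset.card_le_card Finset.inter_subset_right
    have h7 : (2 : ℝ) * H.card ≤ C := by exact_mod_cast hH
    have h8 : ((T ∩ H).card : ℝ) * (1 / (C : ℝ)) ≤ 1 / 2 := by
      rw [mul_one_div, div_le_iff₀ (by linarith)]; linarith
    rw [sub_eq_add_neg]
    linarith
  have h9 : uprob {ρ | |bucketSum x T a ρ| ≤ ε} = 𝔼 ρ, φ (bucketSum x T a ρ) := rfl
  rw [h9]
  refine le_trans ?_ h2
  calc ε / (32 * s) = 1 / 2 * (ε / (16 * s)) := by field_simp; norm_num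
    _ ≤ _ := mul_le_mul h3 h1 (by positivity) (by positivity)

/-- Conditioning on the hash value of i is harmless, since the other coordinates are independent of
it. Bounds for bucket sums uniform in `a` thus pass to the row error. -/
theorem expect_rowNoise [NeZero C] (x : Fin n → ℝ) (i : Fin n) (f : ℝ → ℝ) :
    𝔼 ρ : Fin n → Fin C × ℤˣ, f (rowNoise x i ρ)
      = 𝔼 a : Fin C × ℤˣ, 𝔼 ρ, f (bucketSum x (Finset.univ.erase i) a ρ) := by
  rw [expect_resample i, Finset.expect_comm]
  refine Finset.expect_congr rfl fun a _ => Finset.expect_congr rfl fun ρ _ => ?_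
  rw [rowNoise, Function.update_self, bucketSum_update_of_notMem x (Finset.notMem_erase i _)]

theorem le_uprob_abs_rowNoise_le [NeZero C] (hC2 : 2 ≤ C) (x : Fin n → ℝ) (i : Fin n)
    (H : Finset (Fin n)) (hH : 2 * H.card ≤ C) {s ε : ℝ} (hε : 0 < ε)
    (hεs : ε ≤ s) (hx : ∑ j ∈ Hᶜ, x j ^ 2 ≤ C * s ^ 2) :
    ε / (32 * s) ≤ uprob {ρ : Fin n → Fin C × ℤˣ | |rowNoise x i ρ| ≤ ε} := by
  have h := expect_rowNoise (C := C) x i ({z : ℝ | |z| ≤ ε}.indicator fun _ => (1 : ℝ))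
  refine le_of_le_of_eq ?_ h.symm
  rw [← Fintype.expect_const (ι := Fin C × ℤˣ) (ε / (32 * s))]
  exact Finset.expect_le_expect fun a _ =>
    le_uprob_abs_bucketSum_le hC2 x H _ a hH hε hεs hx

theorem expect_same_column [NeZero C] (v : Fin C) (j : Fin n) :
    𝔼 ρ : Fin n → Fin C × ℤˣ, (if (ρ j).1 = v then (1 : ℝ) else 0) = 1 / C := by
  have hC : (C : ℝ) ≠ 0 := Nat.cast_ne_zero.2 (NeZero.ne C)
  rw [expect_apply_coord j fun a : Fin C × ℤˣ => if a.1 = v then (1 : ℝ) else 0,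
    ← Finset.univ_product_univ, Finset.expect_product]
  refine (Finset.expect_congr rfl fun b _ => Fintype.expect_const _).trans ?_
  rw [Fintype.expect_eq_sum_div_card]
  simp

theorem expect_collision [NeZero C] {i j : Fin n} (hij : i ≠ j) :
    𝔼 ρ : Fin n → Fin C × ℤˣ, (if (ρ i).1 = (ρ j).1 then (1 : ℝ) else 0) = 1 / C := by
  rw [expect_resample j]
  simp only [Function.update_self, Function.update_of_ne hij]
  rw [Finset.expect_comm, ← Fintype.expect_const (ι := Fin C × ℤˣ) (1 / (C : ℝ))]
  exact Finset.expect_congr rfl fun a _ => expect_same_column a.1 i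

/-- Either some coordinate of `H` hits the bucket, which a union bound controls, or only light
coordinates contribute and Chebyshev applies. -/
theorem uprob_lt_abs_bucketSum_le [NeZero C] (x : Fin n → ℝ) (H T : Finset (Fin n))
    (a : Fin C × ℤˣ) {B : ℝ} (hB : 0 < B) :
    uprob {ρ | B < |bucketSum x T a ρ|}
      ≤ H.card / C + (∑ j ∈ Hᶜ, x j ^ 2) / (C * B ^ 2) := by
  have hC : (0 : ℝ) < C := Nat.cast_pos.2 (NeZero.pos C)
  have hpt : uprob {ρ | B < |bucketSum x T a ρ|}
      ≤ 𝔼 ρ : Fin n → Fin C × ℤˣ, ((∑ j ∈ T ∩ H, if (ρ j).1 = a.1 then (1 : ℝ) else 0)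
        + bucketSum x (T \ H) a ρ ^ 2 / B ^ 2) := by
    have hnn : ∀ ρ : Fin n → Fin C × ℤˣ, ∀ j, (0 : ℝ) ≤ if (ρ j).1 = a.1 then (1 : ℝ) else 0 :=
      fun ρ j => by split_ifs <;> norm_num
    refine uprob_le_expect (fun ρ => add_nonneg (Finset.sum_nonneg fun j _ => hnn ρ j)
      (by positivity)) fun ρ hρ => ?_
    by_cases hcol : ∃ j ∈ T ∩ H, (ρ j).1 = a.1
    · obtain ⟨j, hj, hja⟩ := hcol
      have h1 := Finset.single_le_sum (fun j _ => hnn ρ j) hj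
      rw [if_pos hja] at h1
      have h2 : 0 ≤ bucketSum x (T \ H) a ρ ^ 2 / B ^ 2 := by positivity
      linarith
    · push Not at hcol
      have h1 : bucketSum x T a ρ = bucketSum x (T \ H) a ρ := by
        unfold bucketSum
        rw [← Finset.sum_inter_add_sum_sdiff T H, Finset.sum_eq_zero, zero_add]
        exact fun j hj => if_neg (hcol j hj)
      rw [Set.mem_ofPred_eq, h1] at hρ
      have h2 : 1 ≤ bucketSum x (T \ H) a ρ ^ 2 / B ^ 2 := by
        rw [one_le_div (by positivity), ← sq_abs (bucketSum x (T \ H) a ρ)]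
        exact pow_le_pow_left₀ hB.le hρ.le 2
      linarith [Finset.sum_nonneg fun j (_ : j ∈ T ∩ H) => hnn ρ j]
  refine hpt.trans ?_
  rw [Finset.expect_add_distrib, Finset.expect_sum_comm, ← Finset.expect_div,
    expect_bucketSum_sq]
  simp only [expect_same_column, Finset.sum_const, nsmul_eq_mul, mul_one_div]
  rw [div_div]
  gcongr
  · exact Finset.inter_subset_right
  · intro j hj
    simp at hj ⊢; exact hj.2

theorem uprob_lt_abs_rowNoise_le [NeZero C] (x : Fin n → ℝ) (i : Fin n) (H : Finset (Fin n))
    {B : ℝ} (hB : 0 < B) :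
    uprob {ρ : Fin n → Fin C × ℤˣ | B < |rowNoise x i ρ|}
      ≤ H.card / C + (∑ j ∈ Hᶜ, x j ^ 2) / (C * B ^ 2) := by
  have h := expect_rowNoise (C := C) x i ({z : ℝ | B < |z|}.indicator fun _ => (1 : ℝ))
  refine le_of_eq_of_le h ?_
  rw [← Fintype.expect_const (ι := Fin C × ℤˣ) (H.card / C + (∑ j ∈ Hᶜ, x j ^ 2) / (C * B ^ 2))]
  exact Finset.expect_le_expect fun a _ => uprob_lt_abs_bucketSum_le x H _ a hB

/-- Flip the sign of one coordinate in a row. -/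
def flipSign (i : Fin n) (ρ : Fin n → Fin C × ℤˣ) : Fin n → Fin C × ℤˣ :=
  Function.update ρ i ((ρ i).1, -(ρ i).2)

theorem flipSign_involutive (i : Fin n) :
    Function.Involutive (flipSign i : (Fin n → Fin C × ℤˣ) → _) := by
  intro ρ
  simp [flipSign]

theorem expect_flipSign (i : Fin n) (F : (Fin n → Fin C × ℤˣ) → ℝ) :
    𝔼 ρ, F (flipSign i ρ) = 𝔼 ρ, F ρ :=
  Fintype.expect_equiv (flipSign_involutive i).toPerm _ _ fun _ => rfl

theorem flipSign_fst (i j : Fin n) (ρ : Fin n → Fin C × ℤˣ) :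
    (flipSign i ρ j).1 = (ρ j).1 := by
  by_cases h : j = i
  · subst h; simp [flipSign]
  · simp [flipSign, h]

theorem rowNoise_flipSign (x : Fin n → ℝ) (i : Fin n) (ρ : Fin n → Fin C × ℤˣ) :
    rowNoise x i (flipSign i ρ) = -rowNoise x i ρ := by
  unfold rowNoise
  rw [flipSign, bucketSum_update_of_notMem x (Finset.notMem_erase i _), Function.update_self]
  unfold bucketSum
  rw [← Finset.sum_neg_distrib]
  refine Finset.sum_congr rfl fun j _ => ?_
  split_ifs <;> simp

theorem rowNoise_flipSign_of_ne (x : Fin n → ℝ) {i j : Fin n} (ρ : Fin n → Fin C × ℤˣ)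
    (h : (ρ i).1 ≠ (ρ j).1) : rowNoise x j (flipSign i ρ) = rowNoise x j ρ := by
  have hij : j ≠ i := fun e => h (by rw [e])
  unfold rowNoise bucketSum
  refine Finset.sum_congr rfl fun l _ => ?_
  rw [flipSign, Function.update_of_ne hij]
  by_cases hl : l = i
  · subst hl; simp [h]
  · rw [Function.update_of_ne hl]

theorem abs_sign_le_one (z : ℝ) : |Real.sign z| ≤ 1 := by
  rcases Real.sign_apply_eq z with h | h | h <;> simp [h]

theorem expect_sign_rowNoise (x : Fin n → ℝ) (i : Fin n) :
    𝔼 ρ : Fin n → Fin C × ℤˣ, Real.sign (rowNoise x i ρ) = 0 := by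
  have h := expect_flipSign (C := C) i fun ρ => Real.sign (rowNoise x i ρ)
  simp only [rowNoise_flipSign, Real.sign_neg, Finset.expect_neg_distrib] at h
  linarith

/-- Where i and j do not collide, `flipSign i` is a measure-preserving involution that negates the
product, so this part averages to zero. The rest is at most the collision probability. -/
theorem abs_expect_sign_mul_sign_le [NeZero C] (x : Fin n → ℝ) {i j : Fin n} (hij : i ≠ j) :
    |𝔼 ρ : Fin n → Fin C × ℤˣ, Real.sign (rowNoise x i ρ) * Real.sign (rowNoise x j ρ)|
      ≤ 1 / C := by
  set F : (Fin n → Fin C × ℤˣ) → ℝ :=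
    fun ρ => Real.sign (rowNoise x i ρ) * Real.sign (rowNoise x j ρ) with hF
  have hsplit : ∀ ρ, F ρ = (if (ρ i).1 = (ρ j).1 then F ρ else 0)
      + (if (ρ i).1 = (ρ j).1 then 0 else F ρ) := by
    intro ρ; split_ifs <;> simp
  have hzero : 𝔼 ρ, (if (ρ i).1 = (ρ j).1 then 0 else F ρ) = 0 := by
    have h := expect_flipSign i fun ρ => if (ρ i).1 = (ρ j).1 then 0 else F ρ
    have h2 : ∀ ρ, (if (flipSign i ρ i).1 = (flipSign i ρ j).1 then 0 else F (flipSign i ρ))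
        = -(if (ρ i).1 = (ρ j).1 then 0 else F ρ) := by
      intro ρ
      simp only [flipSign_fst]
      split_ifs with h
      · simp
      · simp only [hF, rowNoise_flipSign, rowNoise_flipSign_of_ne x ρ h, Real.sign_neg, neg_mul]
    simp only [h2, Finset.expect_neg_distrib] at h
    linarith
  rw [Finset.expect_congr rfl fun ρ _ => hsplit ρ, Finset.expect_add_distrib, hzero, add_zero,
    ← expect_collision (C := C) hij]
  refine (Finset.abs_expect_le _ _).trans (Finset.expect_le_expect fun ρ _ => ?_)
  split_ifs
  · simp only [hF, abs_mul]
    exact mul_le_one₀ (abs_sign_le_one _) (abs_nonneg _) (abs_sign_le_one _)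
  · simp

end RowLaw

/-! ### Tail and truncated mean square of one estimate. -/

section SingleCoordinate

variable {R n C : ℕ}

/-- The error of the Count-Sketch estimate of a coordinate. -/
noncomputable def sketchError (x : Fin n → ℝ) (i : Fin n) (ω : SketchHash R n C) : ℝ :=
  sketchEstimate ω x i - x i

theorem sketchEstimate_eq (x : Fin n → ℝ) (i : Fin n) (ω : SketchHash R n C) :
    sketchEstimate ω x i = sampleMedian fun u => x i + rowNoise x i (ω u) := by
  unfold sketchEstimate
  congr 1
  ext u
  rw [countSketch, Finset.sum_filter, ← Finset.add_sum_erase _ _ (Finset.mem_univ i), if_pos rfl,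
    mul_add, rowNoise, bucketSum, Finset.mul_sum]
  congr 1
  · rcases Int.units_eq_one_or (ω u i).2 with h | h <;> simp [h]
  · refine Finset.sum_congr rfl fun j _ => ?_
    split_ifs
    · ring
    · simp

theorem abs_sketchError_sub_le (x : Fin n → ℝ) (i : Fin n) (ω ω' : SketchHash R n C) {δ : ℝ}
    (hδ : 0 ≤ δ) (h : ∀ u, |rowNoise x i (ω u) - rowNoise x i (ω' u)| ≤ δ) :
    |sketchError x i ω - sketchError x i ω'| ≤ δ := by
  unfold sketchError
  rw [sub_sub_sub_cancel_right, sketchEstimate_eq, sketchEstimate_eq]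
  refine abs_sampleMedian_sub_le _ _ hδ fun u => ?_
  rw [add_sub_add_left_eq_sub]
  exact h u

theorem le_two_mul_sum_of_lt_sketchError (hR : 0 < R) (x : Fin n → ℝ) (i : Fin n)
    (ω : SketchHash R n C) {ε : ℝ} (h : ε < sketchError x i ω) :
    (R : ℝ) ≤ 2 * ∑ u, {ρ | ε < rowNoise x i ρ}.indicator (fun _ => (1 : ℝ)) (ω u) := by
  rw [sketchError, sketchEstimate_eq, lt_sub_iff_add_lt] at h
  refine (le_two_mul_sum_of_lt_sampleMedian _ hR h).trans (le_of_eq ?_)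
  congr 1
  refine Finset.sum_congr rfl fun u _ => ?_
  simp only [Set.indicator, Set.mem_ofPred_eq]
  congr 1
  rw [add_comm ε, add_lt_add_iff_left]

theorem le_two_mul_sum_of_sketchError_lt (hR : 0 < R) (x : Fin n → ℝ) (i : Fin n)
    (ω : SketchHash R n C) {ε : ℝ} (h : sketchError x i ω < -ε) :
    (R : ℝ) ≤ 2 * ∑ u, {ρ | rowNoise x i ρ < -ε}.indicator (fun _ => (1 : ℝ)) (ω u) := by
  rw [sketchError, sketchEstimate_eq, sub_lt_iff_lt_add'] at h
  refine (le_two_mul_sum_of_sampleMedian_lt _ hR h).trans (le_of_eq ?_)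
  congr 1
  refine Finset.sum_congr rfl fun u _ => ?_
  simp only [Set.indicator, Set.mem_ofPred_eq]
  congr 1
  rw [add_lt_add_iff_left]

theorem uprob_rowNoise_lt_neg (x : Fin n → ℝ) (i : Fin n) (ε : ℝ) :
    uprob {ρ : Fin n → Fin C × ℤˣ | rowNoise x i ρ < -ε}
      = uprob {ρ : Fin n → Fin C × ℤˣ | ε < rowNoise x i ρ} := by
  unfold uprob
  rw [← expect_flipSign i]
  refine Finset.expect_congr rfl fun ρ _ => ?_
  simp only [Set.indicator, Set.mem_ofPred_eq, rowNoise_flipSign, neg_lt_neg_iff]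

/-- By symmetry, the mass near zero is taken equally from the two tails. -/
theorem uprob_lt_rowNoise_le [NeZero C] (x : Fin n → ℝ) (i : Fin n) {ε p : ℝ} (hε : 0 ≤ ε)
    (hp : p ≤ uprob {ρ : Fin n → Fin C × ℤˣ | |rowNoise x i ρ| ≤ ε}) :
    uprob {ρ : Fin n → Fin C × ℤˣ | ε < rowNoise x i ρ} ≤ (1 - p) / 2 := by
  have h1 : uprob {ρ : Fin n → Fin C × ℤˣ | |rowNoise x i ρ| ≤ ε}
      + (uprob {ρ : Fin n → Fin C × ℤˣ | rowNoise x i ρ < -ε}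
      + uprob {ρ : Fin n → Fin C × ℤˣ | ε < rowNoise x i ρ}) = 1 := by
    unfold uprob
    rw [← Finset.expect_add_distrib, ← Finset.expect_add_distrib,
      ← Fintype.expect_const (ι := Fin n → Fin C × ℤˣ) (1 : ℝ)]
    refine Finset.expect_congr rfl fun ρ _ => ?_
    simp only [Set.indicator, Set.mem_ofPred_eq, abs_le]
    split_ifs <;> first | (exfalso; grind) | norm_num
  rw [uprob_rowNoise_lt_neg] at h1
  linarith

/-- A majority bound for rows turns into a bound for the estimate. -/
theorem uprob_lt_abs_sketchError_le [NeZero C] (hR : 0 < R) (x : Fin n → ℝ) (i : Fin n)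
    {ε q : ℝ} (hq0 : 0 < q) (hq : q ≤ 1 / 2)
    (h : uprob {ρ : Fin n → Fin C × ℤˣ | ε < rowNoise x i ρ} ≤ q) :
    uprob {ω : SketchHash R n C | ε < |sketchError x i ω|} ≤ 2 * (2 * √(q * (1 - q))) ^ R := by
  have h1 := uprob_majority_le (ι := Fin R) _ hq0 hq h
  have h2 := uprob_majority_le (ι := Fin R) _ hq0 hq ((uprob_rowNoise_lt_neg x i ε).trans_le h)
  rw [Fintype.card_fin] at h1 h2
  rw [two_mul ((2 * √(q * (1 - q))) ^ R)]
  refine (uprob_mono fun ω hω => ?_).trans ((uprob_union_le _ _).trans (add_le_add h1 h2))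
  rcases lt_abs.1 (show ε < |sketchError x i ω| from hω) with h | h
  · exact Or.inl (le_two_mul_sum_of_lt_sketchError hR x i ω h)
  · exact Or.inr (le_two_mul_sum_of_sketchError_lt hR x i ω (by linarith))

/-- With row probability q = (1 - p)/2 the majority bound is 2√(q(1 - q)) = √(1 - p²) ≤ exp(-p²/2).
The tail is Gaussian at scale s/√R, but only up to s. -/
theorem uprob_lt_abs_sketchError_le_exp [NeZero C] (hC2 : 2 ≤ C) (hR : 0 < R) (x : Fin n → ℝ)
    (i : Fin n) (H : Finset (Fin n)) (hH : 2 * H.card ≤ C) {s ε : ℝ} (hε : 0 < ε)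
    (hεs : ε ≤ s) (hx : ∑ j ∈ Hᶜ, x j ^ 2 ≤ C * s ^ 2) :
    uprob {ω : SketchHash R n C | ε < |sketchError x i ω|}
      ≤ 2 * Real.exp (-(R * (ε / (32 * s)) ^ 2 / 2)) := by
  have hs : 0 < s := hε.trans_le hεs
  set p := ε / (32 * s) with hp
  have hp0 : 0 < p := by positivity
  have hp1 : p < 1 := by rw [hp, div_lt_one (by positivity)]; linarith
  refine (uprob_lt_abs_sketchError_le hR x i (by linarith : 0 < (1 - p) / 2) (by linarith)
    (uprob_lt_rowNoise_le x i hε.le (le_uprob_abs_rowNoise_le hC2 x i H hH hε hεs hx))).trans ?_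
  have hexp : Real.exp (-(R * p ^ 2 / 2)) = Real.exp (-(p ^ 2 / 2)) ^ R := by
    rw [← Real.exp_nat_mul]; ring_nf
  rw [hexp]
  refine mul_le_mul_of_nonneg_left (pow_le_pow_left₀ (by positivity) ?_ R) (by norm_num)
  rw [show (2 : ℝ) = √(2 ^ 2) by simp, ← Real.sqrt_mul (by norm_num)]
  simp only [Real.sqrt_sq (show (0 : ℝ) ≤ 2 by norm_num)]
  refine Real.sqrt_le_iff.2 ⟨(Real.exp_pos _).le, ?_⟩
  rw [← Real.exp_nat_mul]
  have := Real.add_one_le_exp (((2 : ℕ) : ℝ) * -(p ^ 2 / 2))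
  refine le_trans (le_of_eq ?_) this
  push_cast; ring

/-- A layer-cake bound for the square along an arithmetic progression of levels. -/
theorem min_sq_le_sum_levels (y e : ℝ) (hy : 0 ≤ y) (he : 0 < e) (J : ℕ) :
    min y ((J + 1) * e) ^ 2 ≤ e ^ 2 * (1 + ∑ j ∈ Finset.Icc 1 J,
      (2 * (j : ℝ) + 1) * {z : ℝ | j * e < z}.indicator (fun _ => (1 : ℝ)) y) := by
  induction J with
  | zero =>
    simp only [Nat.cast_zero, zero_add, one_mul, Finset.Icc_eq_empty_of_lt zero_lt_one,
      Finset.sum_empty, add_zero, mul_one]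
    exact pow_le_pow_left₀ (le_min hy he.le) (min_le_right _ _) 2
  | succ J ih =>
    rw [Finset.sum_Icc_succ_top (by omega)]
    push_cast
    by_cases h : (J + 1) * e < y
    · rw [min_eq_right h.le] at ih
      have h1 : min y ((J + 1 + 1) * e) ^ 2 ≤ ((J + 1 + 1) * e) ^ 2 :=
        pow_le_pow_left₀ (le_min hy (by positivity)) (min_le_right _ _) 2
      rw [Set.indicator_of_mem (show y ∈ {z : ℝ | (J + 1) * e < z} from h)]
      have h2 : ((J : ℝ) + 1 + 1) ^ 2 * e ^ 2
        = ((J + 1) * e) ^ 2 + (2 * (J + 1) + 1) * e ^ 2 := by ring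
      linarith
    · rw [Set.indicator_of_notMem (show y ∉ {z : ℝ | (J + 1) * e < z} from h)]
      rw [not_lt] at h
      rw [min_eq_left h] at ih
      rw [min_eq_left (by nlinarith)]
      linarith

theorem two_mul_add_one_le_three_pow (j : ℕ) : (2 * (j : ℝ) + 1) ≤ 3 ^ j := by
  have := one_add_mul_le_pow (show (-2 : ℝ) ≤ 2 by norm_num) j
  norm_num at this
  linarith

theorem sum_levels_exp_le_one {L : ℝ} (hL : 3 ≤ L) (J : ℕ) :
    ∑ j ∈ Finset.Icc 1 J, (2 * (j : ℝ) + 1) * (2 * Real.exp (-(L * (j : ℝ) ^ 2))) ≤ 1 := by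
  have hterm : ∀ j ∈ Finset.Icc 1 J,
      (2 * (j : ℝ) + 1) * (2 * Real.exp (-(L * (j : ℝ) ^ 2))) ≤ (1 / 2) ^ j := by
    intro j hj
    have hj1 : (1 : ℝ) ≤ j := by exact_mod_cast (Finset.mem_Icc.1 hj).1
    have h1 : Real.exp (-(L * (j : ℝ) ^ 2)) ≤ (1 / 12) ^ j := by
      have h2 : Real.exp (-3) ≤ 1 / 12 := by
        rw [Real.exp_neg, one_div]
        refine inv_anti₀ (by norm_num) ?_
        have : Real.exp 3 = Real.exp 1 ^ 3 := by rw [← Real.exp_nat_mul]; norm_num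
        rw [this]
        have := Real.exp_one_gt_d9
        calc (12 : ℝ) ≤ 2.7 ^ 3 := by norm_num
          _ ≤ _ := pow_le_pow_left₀ (by norm_num) (by linarith) 3
      refine le_trans ?_ (pow_le_pow_left₀ (Real.exp_pos _).le h2 j)
      rw [← Real.exp_nat_mul]
      refine Real.exp_le_exp.2 ?_
      nlinarith [mul_le_mul hL (show (j : ℝ) ≤ (j : ℝ) ^ 2 by nlinarith) (by linarith) (by linarith)]
    calc (2 * (j : ℝ) + 1) * (2 * Real.exp (-(L * (j : ℝ) ^ 2)))
        ≤ 3 ^ j * (2 ^ j * (1 / 12) ^ j) := by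
          refine mul_le_mul (two_mul_add_one_le_three_pow j) ?_ (by positivity) (by positivity)
          refine mul_le_mul ?_ h1 (Real.exp_pos _).le (by positivity)
          exact le_self_pow₀ (by norm_num) (by have := (Finset.mem_Icc.1 hj).1; omega)
      _ = (1 / 2) ^ j := by rw [← mul_pow, ← mul_pow]; norm_num
  refine (Finset.sum_le_sum hterm).trans ?_
  have : ∑ j ∈ Finset.Icc 1 J, (1 / 2 : ℝ) ^ j = 1 - (1 / 2) ^ J := by
    induction J with
    | zero => simp
    | succ J ih =>
      rw [Finset.sum_Icc_succ_top (by omega),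
        ih fun j hj => hterm j (Finset.Icc_subset_Icc_right (Nat.le_succ J) hj), pow_succ]
      ring
  rw [this]
  linarith [show (0 : ℝ) ≤ (1 / 2) ^ J by positivity]

/-- The truncated mean square error of one coordinate. -/
theorem expect_min_sketchError_sq_le [NeZero C] (hC2 : 2 ≤ C) (hR : 0 < R) (x : Fin n → ℝ)
    (i : Fin n) (H : Finset (Fin n)) (hH : 2 * H.card ≤ C) {s e B : ℝ} (he : 0 < e) (hs : 0 < s)
    (hx : ∑ j ∈ Hᶜ, x j ^ 2 ≤ C * s ^ 2) (hL : 6144 * s ^ 2 ≤ R * e ^ 2) :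
    𝔼 ω : SketchHash R n C, min (sketchError x i ω ^ 2) (B ^ 2)
      ≤ 2 * e ^ 2 + 2 * B ^ 2 * Real.exp (-(R / 2048)) := by
  -- Sum over the levels j·e up to s, where the Gaussian bound holds; beyond s only the truncation
  -- at `B ^ 2` helps. Here 2048 = 2·32² and 6144 = 3·2048, so the Gaussian rate per level is at
  -- least 3.
  set J : ℕ := ⌊s / e⌋₊ with hJ
  have hJle : (J : ℝ) * e ≤ s := by
    rw [← le_div_iff₀ he]; exact Nat.floor_le (by positivity)
  have hJlt : s < (J + 1) * e := by
    rw [← div_lt_iff₀ he]; exact Nat.lt_floor_add_one _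
  have hpt : ∀ ω : SketchHash R n C, min (sketchError x i ω ^ 2) (B ^ 2)
      ≤ e ^ 2 * (1 + ∑ j ∈ Finset.Icc 1 J, (2 * (j : ℝ) + 1) *
        {ω : SketchHash R n C | j * e < |sketchError x i ω|}.indicator (fun _ => (1 : ℝ)) ω)
        + B ^ 2 * {ω : SketchHash R n C | s < |sketchError x i ω|}.indicator
          (fun _ => (1 : ℝ)) ω := by
    intro ω
    have h1 := min_sq_le_sum_levels |sketchError x i ω| e (abs_nonneg _) he J
    have h3 : ∀ j : ℕ, {z : ℝ | j * e < z}.indicator (fun _ => (1 : ℝ)) |sketchError x i ω|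
      = {ω : SketchHash R n C | j * e < |sketchError x i ω|}.indicator (fun _ => (1 : ℝ)) ω :=
      fun j => rfl
    simp only [h3] at h1
    by_cases h : s < |sketchError x i ω|
    · rw [Set.indicator_of_mem (show ω ∈ {ω : SketchHash R n C | s < |sketchError x i ω|} from h)]
      linarith [min_le_right (sketchError x i ω ^ 2) (B ^ 2),
        sq_nonneg (min |sketchError x i ω| ((J + 1) * e))]
    · rw [Set.indicator_of_notMem
        (show ω ∉ {ω : SketchHash R n C | s < |sketchError x i ω|} from h)]
      rw [min_eq_left (by linarith), sq_abs] at h1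
      linarith [min_le_left (sketchError x i ω ^ 2) (B ^ 2)]
  have hprob : ∀ j ∈ Finset.Icc 1 J,
      uprob {ω : SketchHash R n C | j * e < |sketchError x i ω|}
        ≤ 2 * Real.exp (-((R * e ^ 2 / (2048 * s ^ 2)) * (j : ℝ) ^ 2)) := by
    intro j hj
    rw [Finset.mem_Icc] at hj
    have hj0 : (0 : ℝ) < j := by exact_mod_cast hj.1
    have hjJ : (j : ℝ) ≤ J := by exact_mod_cast hj.2
    refine (uprob_lt_abs_sketchError_le_exp hC2 hR x i H hH (mul_pos hj0 he)
      ((mul_le_mul_of_nonneg_right hjJ he.le).trans hJle) hx).trans (le_of_eq ?_)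
    congr 3
    field_simp
    norm_num
  have hprob_s : uprob {ω : SketchHash R n C | s < |sketchError x i ω|}
      ≤ 2 * Real.exp (-(R / 2048)) := by
    refine (uprob_lt_abs_sketchError_le_exp hC2 hR x i H hH hs le_rfl hx).trans (le_of_eq ?_)
    congr 3
    field_simp
    norm_num
  refine (Finset.expect_le_expect fun ω _ => hpt ω).trans ?_
  simp only [Finset.expect_add_distrib, ← Finset.mul_expect, Fintype.expect_const,
    Finset.expect_sum_comm]
  have h4 := sum_levels_exp_le_one (L := R * e ^ 2 / (2048 * s ^ 2))
    (by rw [le_div_iff₀ (by positivity)]; linarith) J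
  have h5 := Finset.sum_le_sum fun j hj =>
    mul_le_mul_of_nonneg_left (hprob j hj) (show 0 ≤ 2 * (j : ℝ) + 1 by positivity)
  have h6 := mul_le_mul_of_nonneg_left (h5.trans h4) (sq_nonneg e)
  have h7 := mul_le_mul_of_nonneg_left hprob_s (sq_nonneg B)
  unfold uprob at h6 h7
  linarith

end SingleCoordinate

/-! ### Few rows: variance of the truncated error. -/

section EfronSteinRegime

variable {R n C : ℕ}

/-- Currying makes each pair (row, coordinate) an independent variable, so that one hash value is
resampled rather than a whole row. -/
theorem efron_stein_hash [NeZero C] (f : SketchHash R n C → ℝ) :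
    𝔼 ω, (f ω - 𝔼 ω', f ω') ^ 2
      ≤ ∑ u, ∑ l, 𝔼 ω, 𝔼 a,
        (f ω - f (Function.update ω u (Function.update (ω u) l a))) ^ 2 := by
  have h := efron_stein fun ω : Fin R × Fin n → Fin C × ℤˣ => f (Function.curry ω)
  let e := Equiv.curry (Fin R) (Fin n) (Fin C × ℤˣ)
  have h1 : ∀ g : SketchHash R n C → ℝ, 𝔼 ω : Fin R × Fin n → Fin C × ℤˣ,
      g (Function.curry ω) = 𝔼 ω, g ω :=
    fun g => Fintype.expect_equiv e _ _ fun _ => rfl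
  rw [h1 f, h1 fun ω => (f ω - 𝔼 ω', f ω') ^ 2] at h
  refine h.trans (le_of_eq ?_)
  rw [Fintype.sum_prod_type]
  refine Finset.sum_congr rfl fun u _ => Finset.sum_congr rfl fun l _ => ?_
  rw [← h1 fun ω => 𝔼 a, (f ω - f (Function.update ω u (Function.update (ω u) l a))) ^ 2]
  refine Finset.expect_congr rfl fun ω _ => Finset.expect_congr rfl fun a _ => ?_
  congr 3
  ext v j : 2
  by_cases hv : v = u
  · subst hv
    by_cases hj : j = l
    · subst hj; simp [Function.curry]
    · simp [Function.curry, hj]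
  · simp [Function.curry, hv]

/-- Rehashing l matters to i only through the bucket it leaves and the bucket it joins. -/
theorem abs_rowNoise_update_sub_le (x : Fin n → ℝ) {i l : Fin n} (hil : i ≠ l)
    (ρ : Fin n → Fin C × ℤˣ) (a : Fin C × ℤˣ) :
    |rowNoise x i ρ - rowNoise x i (Function.update ρ l a)|
      ≤ ((if (ρ i).1 = (ρ l).1 then 1 else 0) + (if (ρ i).1 = a.1 then 1 else 0)) * |x l| := by
  have hl : l ∈ Finset.univ.erase i := Finset.mem_erase.2 ⟨hil.symm, Finset.mem_univ l⟩
  have hrest : ∀ T : Finset (Fin n), l ∉ T →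
      bucketSum x T (ρ i) (Function.update ρ l a) = bucketSum x T (ρ i) ρ :=
    fun T hT => bucketSum_update_of_notMem x hT _ _ _
  have hsplit : ∀ ρ' : Fin n → Fin C × ℤˣ, bucketSum x (Finset.univ.erase i) (ρ i) ρ'
      = (if (ρ' l).1 = (ρ i).1 then ((((ρ i).2 : ℤ) : ℝ) * (((ρ' l).2 : ℤ) : ℝ)) * x l else 0)
        + bucketSum x ((Finset.univ.erase i).erase l) (ρ i) ρ' :=
    fun ρ' => (Finset.add_sum_erase _ _ hl).symm
  have habs : ∀ s s' : ℤˣ, |(((s : ℤ) : ℝ) * ((s' : ℤ) : ℝ)) * x l| = |x l| := by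
    intro s s'
    rcases Int.units_eq_one_or s with h | h <;> rcases Int.units_eq_one_or s' with h' | h' <;>
      simp [h, h']
  have hterm : ∀ b : Fin C × ℤˣ,
      |if b.1 = (ρ i).1 then ((((ρ i).2 : ℤ) : ℝ) * ((b.2 : ℤ) : ℝ)) * x l else 0|
        = (if (ρ i).1 = b.1 then 1 else 0) * |x l| := by
    intro b
    by_cases h : b.1 = (ρ i).1
    · rw [if_pos h, if_pos h.symm, habs, one_mul]
    · rw [if_neg h, if_neg (Ne.symm h), abs_zero, zero_mul]
  rw [rowNoise, rowNoise, Function.update_of_ne hil, hsplit, hsplit (Function.update ρ l a),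
    hrest _ (Finset.notMem_erase l _), add_sub_add_right_eq_sub, Function.update_self, add_mul]
  refine (abs_sub _ _).trans ?_
  rw [hterm, hterm]

theorem abs_min_sq_sub_le {B : ℝ} (hB : 0 ≤ B) (y z : ℝ) :
    |min (y ^ 2) (B ^ 2) - min (z ^ 2) (B ^ 2)| ≤ min (B ^ 2) (2 * B * |y - z|) := by
  have hsq : ∀ y : ℝ, min (y ^ 2) (B ^ 2) = min |y| B ^ 2 := by
    intro y
    rcases le_total |y| B with h | h
    · rw [min_eq_left h, sq_abs, min_eq_left (by rw [← sq_abs y]; gcongr)]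
    · rw [min_eq_right h, min_eq_right (by rw [← sq_abs y]; gcongr)]
  refine le_min ?_ ?_
  · rw [abs_sub_le_iff]
    have h1 := min_le_right (y ^ 2) (B ^ 2)
    have h2 := min_le_right (z ^ 2) (B ^ 2)
    have h3 := le_min (sq_nonneg y) (sq_nonneg B)
    have h4 := le_min (sq_nonneg z) (sq_nonneg B)
    constructor <;> linarith
  · rw [hsq, hsq, sq_sub_sq, abs_mul]
    have h1 : |min |y| B - min |z| B| ≤ |y - z| := by
      refine (abs_min_sub_min_le_max _ _ _ _).trans ?_
      simp only [sub_self, abs_zero]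
      exact max_le (abs_abs_sub_abs_le_abs_sub y z) (abs_nonneg _)
    have h2 : |min |y| B + min |z| B| ≤ 2 * B := by
      rw [abs_of_nonneg (add_nonneg (le_min (abs_nonneg _) hB) (le_min (abs_nonneg _) hB))]
      linarith [min_le_right |y| B, min_le_right |z| B]
    exact mul_le_mul h2 h1 (abs_nonneg _) (by linarith)

/-- The number of coordinates of `T` hashed to the column `v`. -/
noncomputable def columnLoad (T : Finset (Fin n)) (v : Fin C) (ρ : Fin n → Fin C × ℤˣ) : ℝ :=
  ∑ i ∈ T, if (ρ i).1 = v then 1 else 0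

/-- The diagonal gives |T|/C and the independent pairs at most (|T|/C)², which is no larger because
|T| ≤ C. -/
theorem expect_columnLoad_sq_le [NeZero C] (T : Finset (Fin n)) (hT : T.card ≤ C) (v : Fin C) :
    𝔼 ρ, columnLoad T v ρ ^ 2 ≤ 2 * (T.card / C) := by
  have hC : (0 : ℝ) < C := Nat.cast_pos.2 (NeZero.pos C)
  have hT' : (T.card : ℝ) ≤ C := by exact_mod_cast hT
  have hpair : ∀ i ∈ T, ∀ j ∈ T, 𝔼 ρ : Fin n → Fin C × ℤˣ,
      (if (ρ i).1 = v then (1 : ℝ) else 0) * (if (ρ j).1 = v then 1 else 0)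
        ≤ (if i = j then 1 / (C : ℝ) else 0) + 1 / C * (1 / C) := by
    intro i _ j _
    by_cases hij : i = j
    · subst hij
      rw [if_pos rfl]
      simp only [mul_ite, mul_one, mul_zero]
      refine le_trans (Finset.expect_le_expect fun ρ _ => ?_) ((expect_same_column v i).trans_le
        (le_add_of_nonneg_right (by positivity)))
      split_ifs <;> norm_num
    · rw [if_neg hij, zero_add, expect_resample j]
      simp only [Function.update_self, Function.update_of_ne hij, ← Finset.mul_expect]
      rw [← Finset.expect_mul, expect_same_column]
      refine le_of_eq ?_
      rw [← expect_same_column (n := n) v j,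
        expect_apply_coord j fun a : Fin C × ℤˣ => if a.1 = v then (1 : ℝ) else 0]
  have hexp : ∀ ρ : Fin n → Fin C × ℤˣ, columnLoad T v ρ ^ 2 = ∑ i ∈ T, ∑ j ∈ T,
      (if (ρ i).1 = v then (1 : ℝ) else 0) * (if (ρ j).1 = v then 1 else 0) := by
    intro ρ
    rw [columnLoad, pow_two, Finset.sum_mul_sum]
  simp only [hexp, Finset.expect_sum_comm]
  refine (Finset.sum_le_sum fun i hi => Finset.sum_le_sum fun j hj => hpair i hi j hj).trans ?_
  have hinner : ∀ i ∈ T, ∑ j ∈ T, ((if i = j then 1 / (C : ℝ) else 0) + 1 / C * (1 / C))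
      = 1 / C + T.card * (1 / C * (1 / C)) := by
    intro i hi
    rw [Finset.sum_add_distrib, Finset.sum_ite_eq, if_pos hi, Finset.sum_const, nsmul_eq_mul]
  rw [Finset.sum_congr rfl hinner, Finset.sum_const, nsmul_eq_mul]
  have h1 : (T.card : ℝ) * (1 / C * (1 / C)) ≤ 1 / C := by
    rw [← mul_assoc, mul_one_div (T.card : ℝ)]
    exact mul_le_of_le_one_left (by positivity) ((div_le_one hC).2 hT')
  calc (T.card : ℝ) * (1 / C + T.card * (1 / C * (1 / C))) ≤ T.card * (1 / C + 1 / C) := by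
        gcongr
    _ = _ := by ring

/-- The truncated total square error over a set of coordinates. -/
noncomputable def truncatedError (x : Fin n → ℝ) (S : Finset (Fin n)) (B : ℝ)
    (ω : SketchHash R n C) : ℝ :=
  ∑ i ∈ S, min (sketchError x i ω ^ 2) (B ^ 2)

theorem abs_truncatedError_sub_le (x : Fin n → ℝ) (S : Finset (Fin n)) {B : ℝ} (hB : 0 ≤ B)
    (ω : SketchHash R n C) (u : Fin R) (l : Fin n) (a : Fin C × ℤˣ) :
    |truncatedError x S B ω
        - truncatedError x S B (Function.update ω u (Function.update (ω u) l a))|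
      ≤ (if l ∈ S then B ^ 2 else 0) + min (B ^ 2) (2 * B * |x l|) *
        (columnLoad (S.erase l) (ω u l).1 (ω u) + columnLoad (S.erase l) a.1 (ω u)) := by
  set ω' : SketchHash R n C := Function.update ω u (Function.update (ω u) l a) with hω'
  set ψ : Fin n → SketchHash R n C → ℝ := fun i ω => min (sketchError x i ω ^ 2) (B ^ 2) with hψ
  have hne : ∀ i ∈ S.erase l, |ψ i ω - ψ i ω'| ≤ min (B ^ 2) (2 * B * |x l|) *
      ((if (ω u i).1 = (ω u l).1 then 1 else 0) + (if (ω u i).1 = a.1 then 1 else 0)) := by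
    intro i hi
    have hil : i ≠ l := (Finset.mem_erase.1 hi).1
    set κ : ℝ := (if (ω u i).1 = (ω u l).1 then 1 else 0) + (if (ω u i).1 = a.1 then 1 else 0)
      with hκ
    -- The number of affected buckets is an integer: if zero nothing changes, and otherwise the cap
    -- `B ^ 2` is at most κ times itself.
    have hκ01 : κ = 0 ∨ 1 ≤ κ := by
      rw [hκ]; split_ifs <;> norm_num
    have hκ0 : 0 ≤ κ := by rcases hκ01 with h | h <;> linarith
    have herr : |sketchError x i ω - sketchError x i ω'| ≤ κ * |x l| := by
      refine abs_sketchError_sub_le x i ω ω' (mul_nonneg hκ0 (abs_nonneg _)) fun v => ?_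
      by_cases hv : v = u
      · subst hv
        rw [hω', Function.update_self]
        exact abs_rowNoise_update_sub_le x hil (ω v) a
      · rw [hω', Function.update_of_ne hv, sub_self, abs_zero]
        exact mul_nonneg hκ0 (abs_nonneg _)
    have h1 := abs_min_sq_sub_le hB (sketchError x i ω) (sketchError x i ω')
    have h2 : 2 * B * |sketchError x i ω - sketchError x i ω'| ≤ κ * (2 * B * |x l|) := by
      calc 2 * B * |sketchError x i ω - sketchError x i ω'| ≤ 2 * B * (κ * |x l|) := by gcongr
        _ = _ := by ring
    rw [mul_comm _ κ, mul_min_of_nonneg _ _ hκ0]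
    refine le_min ?_ ((h1.trans (min_le_right _ _)).trans h2)
    rcases hκ01 with h | h
    · have := (h1.trans (min_le_right _ _)).trans h2
      rw [h] at this ⊢
      simpa using this
    · exact (h1.trans (min_le_left _ _)).trans (le_mul_of_one_le_left (sq_nonneg B) h)
  have hsum : ∑ i ∈ S.erase l, |ψ i ω - ψ i ω'| ≤ min (B ^ 2) (2 * B * |x l|) *
      (columnLoad (S.erase l) (ω u l).1 (ω u) + columnLoad (S.erase l) a.1 (ω u)) := by
    refine (Finset.sum_le_sum hne).trans (le_of_eq ?_)
    rw [← Finset.mul_sum, Finset.sum_add_distrib]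
    rfl
  have hself : |ψ l ω - ψ l ω'| ≤ B ^ 2 := (abs_min_sq_sub_le hB _ _).trans (min_le_left _ _)
  have htot : |truncatedError x S B ω - truncatedError x S B ω'| ≤ ∑ i ∈ S, |ψ i ω - ψ i ω'| := by
    unfold truncatedError
    rw [← Finset.sum_sub_distrib]
    exact Finset.abs_sum_le_sum_abs _ _
  refine htot.trans ?_
  split_ifs with hl
  · rw [← Finset.add_sum_erase _ _ hl]
    exact add_le_add hself hsum
  · rw [← Finset.erase_eq_of_notMem hl, zero_add, Finset.erase_idem]
    exact hsum

theorem expect_truncatedError_update_sq_le [NeZero C] (x : Fin n → ℝ) (S : Finset (Fin n))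
    (hS : S.card ≤ C) {B : ℝ} (hB : 0 ≤ B) (u : Fin R) (l : Fin n) :
    𝔼 ω : SketchHash R n C, 𝔼 a, (truncatedError x S B ω
        - truncatedError x S B (Function.update ω u (Function.update (ω u) l a))) ^ 2
      ≤ 3 * (if l ∈ S then B ^ 4 else 0)
        + 12 * (S.card / C) * min (B ^ 2) (2 * B * |x l|) ^ 2 := by
  set w := min (B ^ 2) (2 * B * |x l|) with hw
  have hC : (0 : ℝ) < C := Nat.cast_pos.2 (NeZero.pos C)
  have hpt : ∀ (ω : SketchHash R n C) (a : Fin C × ℤˣ), (truncatedError x S B ω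
        - truncatedError x S B (Function.update ω u (Function.update (ω u) l a))) ^ 2
      ≤ 3 * (if l ∈ S then B ^ 4 else 0) + 3 * w ^ 2 *
        (columnLoad (S.erase l) (ω u l).1 (ω u) ^ 2 + columnLoad (S.erase l) a.1 (ω u) ^ 2) := by
    intro ω a
    have h := abs_truncatedError_sub_le x S hB ω u l a
    rw [← hw] at h
    rw [← sq_abs]
    refine (pow_le_pow_left₀ (abs_nonneg _) h 2).trans ?_
    have h2 : (if l ∈ S then B ^ 4 else 0) = (if l ∈ S then B ^ 2 else 0) ^ 2 := by
      split_ifs <;> ring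
    rw [h2]
    set p := (if l ∈ S then B ^ 2 else 0)
    set q := w * columnLoad (S.erase l) (ω u l).1 (ω u) with hq
    set r := w * columnLoad (S.erase l) a.1 (ω u) with hr
    have h3 : 3 * w ^ 2 * (columnLoad (S.erase l) (ω u l).1 (ω u) ^ 2
        + columnLoad (S.erase l) a.1 (ω u) ^ 2) = 3 * q ^ 2 + 3 * r ^ 2 := by
      rw [hq, hr]; ring
    rw [h3, mul_add, ← hq, ← hr]
    nlinarith [sq_nonneg (p - q), sq_nonneg (p - r), sq_nonneg (q - r)]
  have hcard : (S.erase l).card ≤ C := (Finset.card_erase_le).trans hS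
  have hload : ∀ v : Fin C, 𝔼 ρ, columnLoad (S.erase l) v ρ ^ 2 ≤ 2 * (S.card / C) := by
    intro v
    refine (expect_columnLoad_sq_le _ hcard v).trans ?_
    gcongr
    exact Finset.erase_subset _ _
  have h2 : 𝔼 ω : SketchHash R n C, 𝔼 a : Fin C × ℤˣ, columnLoad (S.erase l) a.1 (ω u) ^ 2
      ≤ 2 * (S.card / C) := by
    rw [Finset.expect_comm, ← Fintype.expect_const (ι := Fin C × ℤˣ) (2 * ((S.card : ℝ) / C))]
    refine Finset.expect_le_expect fun a _ => ?_
    rw [expect_apply_coord u fun ρ => columnLoad (S.erase l) a.1 ρ ^ 2]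
    exact hload a.1
  have h1 : 𝔼 ω : SketchHash R n C, columnLoad (S.erase l) (ω u l).1 (ω u) ^ 2
      ≤ 2 * (S.card / C) := by
    -- Since l is erased from S, the load does not involve its hash value, so the column of l can be
    -- fixed first.
    rw [expect_apply_coord u fun ρ => columnLoad (S.erase l) (ρ l).1 ρ ^ 2, expect_resample l,
      Finset.expect_comm, ← Fintype.expect_const (ι := Fin C × ℤˣ) (2 * ((S.card : ℝ) / C))]
    refine Finset.expect_le_expect fun a _ => le_of_eq_of_le ?_ (hload a.1)
    refine Finset.expect_congr rfl fun ρ _ => ?_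
    rw [Function.update_self]
    congr 1
    refine Finset.sum_congr rfl fun i hi => ?_
    rw [Function.update_of_ne (Finset.mem_erase.1 hi).1]
  refine (Finset.expect_le_expect fun ω _ => Finset.expect_le_expect fun a _ => hpt ω a).trans ?_
  simp only [Finset.expect_add_distrib, ← Finset.mul_expect, Fintype.expect_const]
  have := mul_le_mul_of_nonneg_left (add_le_add h1 h2) (show 0 ≤ 3 * w ^ 2 by positivity)
  linarith

/-- The squared influences sum to O(C B⁴): heavy coordinates are capped at B² and number at most
C/2, while light ones total at most 4B²·Cs² ≤ CB⁴ since 2s ≤ B. The expected squared load |S|/C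
turns this into O(|S|B⁴) per row. -/
theorem variance_truncatedError_le [NeZero C] (x : Fin n → ℝ) (S H : Finset (Fin n))
    (hS : S.card ≤ C) (hH : 2 * H.card ≤ C) {B s : ℝ} (hB : 0 ≤ B) (hs : 0 ≤ s) (hsB : 2 * s ≤ B)
    (hx : ∑ j ∈ Hᶜ, x j ^ 2 ≤ C * s ^ 2) :
    𝔼 ω : SketchHash R n C, (truncatedError x S B ω
        - 𝔼 ω' : SketchHash R n C, truncatedError x S B ω') ^ 2 ≤ 21 * R * S.card * B ^ 4 := by
  have hC : (0 : ℝ) < C := Nat.cast_pos.2 (NeZero.pos C)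
  have hH' : (2 : ℝ) * H.card ≤ C := by exact_mod_cast hH
  have hw : ∑ l, min (B ^ 2) (2 * B * |x l|) ^ 2 ≤ 3 / 2 * C * B ^ 4 := by
    rw [← Finset.sum_add_sum_compl H]
    have h1 : ∑ l ∈ H, min (B ^ 2) (2 * B * |x l|) ^ 2 ≤ H.card * B ^ 4 := by
      rw [← nsmul_eq_mul]
      refine Finset.sum_le_card_nsmul _ _ _ fun l _ => ?_
      calc min (B ^ 2) (2 * B * |x l|) ^ 2 ≤ (B ^ 2) ^ 2 :=
            pow_le_pow_left₀ (le_min (by positivity) (by positivity)) (min_le_left _ _) 2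
        _ = B ^ 4 := by ring
    have h2 : ∑ l ∈ Hᶜ, min (B ^ 2) (2 * B * |x l|) ^ 2 ≤ C * B ^ 4 := by
      calc ∑ l ∈ Hᶜ, min (B ^ 2) (2 * B * |x l|) ^ 2 ≤ ∑ l ∈ Hᶜ, 4 * B ^ 2 * x l ^ 2 := by
            refine Finset.sum_le_sum fun l _ => ?_
            calc min (B ^ 2) (2 * B * |x l|) ^ 2 ≤ (2 * B * |x l|) ^ 2 :=
                  pow_le_pow_left₀ (le_min (by positivity) (by positivity)) (min_le_right _ _) 2
              _ = 4 * B ^ 2 * x l ^ 2 := by rw [mul_pow, sq_abs]; ring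
        _ ≤ 4 * B ^ 2 * (C * s ^ 2) := by rw [← Finset.mul_sum]; gcongr
        _ = C * (B ^ 2 * (2 * s) ^ 2) := by ring
        _ ≤ C * (B ^ 2 * B ^ 2) := by gcongr
        _ = C * B ^ 4 := by ring
    have h3 := mul_le_mul_of_nonneg_right hH' (show 0 ≤ B ^ 4 by positivity)
    linarith
  refine (efron_stein_hash _).trans ((Finset.sum_le_sum fun u _ => Finset.sum_le_sum fun l _ =>
    expect_truncatedError_update_sq_le x S hS hB u l).trans ?_)
  rw [Finset.sum_const, Finset.card_univ, Fintype.card_fin, nsmul_eq_mul, Finset.sum_add_distrib,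
    ← Finset.mul_sum, ← Finset.mul_sum, Finset.sum_ite_mem, Finset.univ_inter, Finset.sum_const,
    nsmul_eq_mul]
  have h4 := mul_le_mul_of_nonneg_left hw (show 0 ≤ 12 * ((S.card : ℝ) / C) by positivity)
  have h5 : 12 * ((S.card : ℝ) / C) * (3 / 2 * C * B ^ 4) = 18 * (S.card * B ^ 4) := by
    field_simp; ring
  rw [h5] at h4
  calc (R : ℝ) * (3 * (S.card * B ^ 4)
        + 12 * ((S.card : ℝ) / C) * ∑ l, min (B ^ 2) (2 * B * |x l|) ^ 2)
      ≤ R * (3 * (S.card * B ^ 4) + 18 * (S.card * B ^ 4)) := by gcongr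
    _ = _ := by ring

/-- The set estimate when the number of rows is small compared with the set. -/
theorem uprob_set_error_few_rows [NeZero C] (hC2 : 2 ≤ C) (hR : 0 < R) (x : Fin n → ℝ)
    (S H : Finset (Fin n)) (hSne : S.Nonempty) (hS : S.card ≤ C) (hH : 2 * H.card ≤ C)
    {s B t q : ℝ} (hs : 0 < s) (ht : 0 < t) (hsB : 2 * s ≤ B)
    (hx : ∑ j ∈ Hᶜ, x j ^ 2 ≤ C * s ^ 2) (hst : 49152 * s ^ 2 ≤ t * B ^ 2)
    (hRt : 8 * R * Real.exp (-(R / 2048)) ≤ t) (hq0 : 0 < q) (hq : q ≤ 1 / 2)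
    (hHq : H.card / C + (∑ j ∈ Hᶜ, x j ^ 2) / (C * B ^ 2) ≤ q) :
    uprob {ω : SketchHash R n C | t * S.card * (1 / R) * B ^ 2 < ∑ i ∈ S, sketchError x i ω ^ 2}
      ≤ S.card * (2 * (2 * √q) ^ R) + 84 / t ^ 2 * (R ^ 3 / S.card) := by
  have hB : 0 < B := by linarith
  have hR' : (0 : ℝ) < R := Nat.cast_pos.2 hR
  have hm : (0 : ℝ) < S.card := Nat.cast_pos.2 hSne.card_pos
  set μ := 𝔼 ω' : SketchHash R n C, truncatedError x S B ω' with hμ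
  -- Half of the target: the mean stays below θ, and Chebyshev handles a deviation of another θ.
  set θ := S.card * (t * B ^ 2 / (2 * R)) with hθ
  have hθ0 : 0 < θ := by positivity
  have hmean : μ ≤ θ := by
    have h1 : ∀ i ∈ S, 𝔼 ω : SketchHash R n C, min (sketchError x i ω ^ 2) (B ^ 2)
        ≤ t * B ^ 2 / (2 * R) := by
      intro i _
      -- Chosen so that 2e² is half of the allowed mean per coordinate; the exponential term fills
      -- the other half.
      set e := √(t * B ^ 2 / (8 * R)) with he
      have he2 : e ^ 2 = t * B ^ 2 / (8 * R) := Real.sq_sqrt (by positivity)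
      have he0 : 0 < e := Real.sqrt_pos.2 (by positivity)
      refine (expect_min_sketchError_sq_le hC2 hR x i H hH he0 hs hx ?_).trans ?_
      · rw [he2]
        have : (R : ℝ) * (t * B ^ 2 / (8 * R)) = t * B ^ 2 / 8 := by field_simp
        rw [this]; linarith
      · rw [he2]
        have h2 : Real.exp (-((R : ℝ) / 2048)) ≤ t / (8 * R) := by
          rw [le_div_iff₀ (by positivity)]; linarith
        have h3 := mul_le_mul_of_nonneg_left h2 (show 0 ≤ 2 * B ^ 2 by positivity)
        refine (add_le_add_right h3 _).trans (le_of_eq ?_)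
        field_simp
        norm_num
    rw [hμ]
    unfold truncatedError
    rw [Finset.expect_sum_comm, hθ, ← nsmul_eq_mul]
    exact Finset.sum_le_card_nsmul _ _ _ h1
  have hlarge : ∀ i ∈ S, uprob {ω : SketchHash R n C | B < |sketchError x i ω|}
      ≤ 2 * (2 * √q) ^ R := by
    intro i _
    refine (uprob_lt_abs_sketchError_le hR x i hq0 hq ((uprob_mono fun ρ hρ => ?_).trans
      ((uprob_lt_abs_rowNoise_le x i H hB).trans hHq))).trans ?_
    · exact (show B < rowNoise x i ρ from hρ).trans_le (le_abs_self _)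
    · gcongr
      exact mul_le_of_le_one_right hq0.le (by linarith)
  have hcheb : uprob {ω : SketchHash R n C | 2 * θ < truncatedError x S B ω}
      ≤ 84 / t ^ 2 * (R ^ 3 / S.card) := by
    refine (uprob_le_div (f := fun ω => (truncatedError x S B ω - μ) ^ 2)
      (pow_pos hθ0 2) (fun _ => sq_nonneg _) fun ω hω => ?_).trans ?_
    · have : 2 * θ < truncatedError x S B ω := hω
      exact pow_le_pow_left₀ hθ0.le (by linarith) 2
    · rw [div_le_iff₀ (by positivity)]
      refine (variance_truncatedError_le x S H hS hH hB.le hs.le hsB hx).trans (le_of_eq ?_)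
      rw [hθ]
      field_simp
      norm_num
  refine (uprob_mono fun ω hω => ?_).trans ((uprob_union_le _ _).trans
    (add_le_add (uprob_biUnion_le_card_mul S _ hlarge) hcheb))
  by_cases hex : ∃ i ∈ S, B < |sketchError x i ω|
  · obtain ⟨i, hi, hBi⟩ := hex
    exact Or.inl (Set.mem_biUnion hi hBi)
  · push Not at hex
    right
    have h1 : truncatedError x S B ω = ∑ i ∈ S, sketchError x i ω ^ 2 := by
      refine Finset.sum_congr rfl fun i hi => min_eq_left ?_
      rw [← sq_abs]
      exact pow_le_pow_left₀ (abs_nonneg _) (hex i hi) 2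
    rw [Set.mem_ofPred_eq] at hω ⊢
    rw [h1]
    refine lt_of_eq_of_lt ?_ hω
    rw [hθ]
    field_simp

end EfronSteinRegime

/-! ### Second moment of an off-diagonal quadratic form. -/

section QuadraticForm

variable {Ω κ : Type*} [Fintype Ω]

theorem expect_fin_succ {R : ℕ} (F : (Fin (R + 1) → Ω) → ℝ) :
    𝔼 ω, F ω = 𝔼 a, 𝔼 ω : Fin R → Ω, F (Fin.cons a ω) := by
  rw [← Finset.expect_product', Finset.univ_product_univ]
  exact (Fintype.expect_equiv (Fin.consEquiv fun _ => Ω) _ _ fun _ => rfl).symm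

theorem expect_sum_mul_sum [Nonempty Ω] (R : ℕ) (f g : Ω → ℝ) (hf : 𝔼 a, f a = 0) (hg : 𝔼 a, g a = 0) :
    𝔼 ω : Fin R → Ω, (∑ u, f (ω u)) * (∑ u, g (ω u)) = R * 𝔼 a, f a * g a := by
  induction R with
  | zero => simp
  | succ R ih =>
    rw [expect_fin_succ]
    simp only [Fin.sum_univ_succ, Fin.cons_zero, Fin.cons_succ, add_mul, mul_add,
      Finset.expect_add_distrib, Fintype.expect_const, ← Finset.mul_expect, ← Finset.expect_mul,
      hf, hg, zero_mul, mul_zero, add_zero, zero_add, ih]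
    push_cast; ring

/-- The off-diagonal part of `∑ i ∈ S, (∑ u, ζ i (ω u)) ^ 2`. -/
noncomputable def offDiagonal {R : ℕ} (S : Finset κ) (ζ : κ → Ω → ℝ) (ω : Fin R → Ω) : ℝ :=
  ∑ i ∈ S, ((∑ u, ζ i (ω u)) ^ 2 - ∑ u, ζ i (ω u) ^ 2)

/-- Adding a row changes the form by 2L, with L linear in the fresh row and of conditional mean
zero. The increments are therefore orthogonal, and the one after R rows has second moment 4R times
the double sum. -/
theorem expect_offDiagonal_sq_le [Nonempty Ω] (R : ℕ) (S : Finset κ) (ζ : κ → Ω → ℝ)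
    (hζ : ∀ i, 𝔼 a, ζ i a = 0) :
    𝔼 ω : Fin R → Ω, offDiagonal S ζ ω ^ 2
      ≤ 2 * R ^ 2 * ∑ i ∈ S, ∑ j ∈ S, (𝔼 a, ζ i a * ζ j a) ^ 2 := by
  induction R with
  | zero => simp [offDiagonal]
  | succ R ih =>
    set V := ∑ i ∈ S, ∑ j ∈ S, (𝔼 a, ζ i a * ζ j a) ^ 2 with hV
    have hV0 : 0 ≤ V := Finset.sum_nonneg fun _ _ => Finset.sum_nonneg fun _ _ => sq_nonneg _
    let L : Ω → (Fin R → Ω) → ℝ := fun a ω => ∑ i ∈ S, ζ i a * ∑ u, ζ i (ω u)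
    have hstep : ∀ a (ω : Fin R → Ω), offDiagonal S ζ (Fin.cons a ω : Fin (R + 1) → Ω) ^ 2
        = offDiagonal S ζ ω ^ 2 + 4 * (offDiagonal S ζ ω * L a ω) + 4 * L a ω ^ 2 := by
      intro a ω
      have h : offDiagonal S ζ (Fin.cons a ω : Fin (R + 1) → Ω)
          = offDiagonal S ζ ω + 2 * L a ω := by
        unfold offDiagonal
        simp only [L]
        rw [Finset.mul_sum S, ← Finset.sum_add_distrib]
        refine Finset.sum_congr rfl fun i _ => ?_
        simp only [Fin.sum_univ_succ, Fin.cons_zero, Fin.cons_succ]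
        ring
      rw [h]; ring
    have hcross : 𝔼 a, 𝔼 ω : Fin R → Ω, offDiagonal S ζ ω * L a ω = 0 := by
      rw [Finset.expect_comm]
      refine Finset.expect_eq_zero fun ω _ => ?_
      rw [← Finset.mul_expect]
      simp only [L, Finset.expect_sum_comm, ← Finset.expect_mul, hζ, zero_mul,
        Finset.sum_const_zero, mul_zero]
    have hL : 𝔼 a, 𝔼 ω : Fin R → Ω, L a ω ^ 2 = R * V := by
      have hLsq : ∀ a ω, L a ω ^ 2 = ∑ i ∈ S, ∑ j ∈ S,
          (ζ i a * ζ j a) * ((∑ u, ζ i (ω u)) * ∑ u, ζ j (ω u)) := by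
        intro a ω
        simp only [L]
        rw [pow_two, Finset.sum_mul_sum]
        exact Finset.sum_congr rfl fun i _ => Finset.sum_congr rfl fun j _ => by ring
      simp only [hLsq, Finset.expect_sum_comm, ← Finset.mul_expect, ← Finset.expect_mul]
      rw [hV, Finset.mul_sum]
      refine Finset.sum_congr rfl fun i _ => ?_
      rw [Finset.mul_sum]
      refine Finset.sum_congr rfl fun j _ => ?_
      rw [expect_sum_mul_sum R _ _ (hζ i) (hζ j)]
      ring
    rw [expect_fin_succ]
    simp only [hstep, Finset.expect_add_distrib, ← Finset.mul_expect, hcross, hL,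
      Fintype.expect_const]
    push_cast
    nlinarith

end QuadraticForm

/-! ### Many rows: linearizing the median by signs. -/

section ManyRows

variable {R n C : ℕ}

/-- The indicator of `(0, ε]`, with weight one half at zero. -/
noncomputable def halfBall (ε z : ℝ) : ℝ :=
  if 0 < z ∧ z ≤ ε then 1 else if z = 0 then 1 / 2 else 0

theorem halfBall_nonneg (ε z : ℝ) : 0 ≤ halfBall ε z := by
  unfold halfBall; split_ifs <;> norm_num

theorem halfBall_le_one (ε z : ℝ) : halfBall ε z ≤ 1 := by
  unfold halfBall; split_ifs <;> norm_num

theorem halfBall_add_halfBall_neg {ε : ℝ} (hε : 0 ≤ ε) (z : ℝ) :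
    halfBall ε z + halfBall ε (-z) = {z : ℝ | |z| ≤ ε}.indicator (fun _ => (1 : ℝ)) z := by
  simp only [halfBall, Set.indicator, Set.mem_ofPred_eq, abs_le]
  split_ifs <;> first | (exfalso; grind) | norm_num

/-- The weight one half at zero makes the identity exact there, where the sign vanishes. -/
theorem sign_eq_two_mul_halfBall {ε : ℝ} (hε : 0 ≤ ε) (z : ℝ) :
    Real.sign z = 2 * halfBall ε z + (2 * {z : ℝ | ε < z}.indicator (fun _ => (1 : ℝ)) z - 1) := by
  simp only [halfBall, Set.indicator, Set.mem_ofPred_eq, Real.sign]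
  split_ifs <;> first | (exfalso; grind) | norm_num

theorem expect_halfBall_rowNoise {ε : ℝ} (hε : 0 ≤ ε) (x : Fin n → ℝ) (i : Fin n) :
    𝔼 ρ : Fin n → Fin C × ℤˣ, halfBall ε (rowNoise x i ρ)
        = uprob {ρ : Fin n → Fin C × ℤˣ | |rowNoise x i ρ| ≤ ε} / 2 ∧
      𝔼 ρ : Fin n → Fin C × ℤˣ, halfBall ε (-rowNoise x i ρ)
        = uprob {ρ : Fin n → Fin C × ℤˣ | |rowNoise x i ρ| ≤ ε} / 2 := by
  have h1 := expect_flipSign (C := C) i fun ρ => halfBall ε (rowNoise x i ρ)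
  simp only [rowNoise_flipSign] at h1
  have h2 : (𝔼 ρ : Fin n → Fin C × ℤˣ, halfBall ε (rowNoise x i ρ))
      + 𝔼 ρ : Fin n → Fin C × ℤˣ, halfBall ε (-rowNoise x i ρ)
      = uprob {ρ : Fin n → Fin C × ℤˣ | |rowNoise x i ρ| ≤ ε} := by
    rw [← Finset.expect_add_distrib]
    exact Finset.expect_congr rfl fun ρ _ => halfBall_add_halfBall_neg hε _
  constructor <;> linarith

/-- If at least half of the rows exceed ε, their contribution 2·1{z > ε} - 1 sums to something
nonnegative, so the rows in (0, ε] are excess in the sum of signs. -/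
theorem two_mul_sum_halfBall_le (hR : 0 < R) (x : Fin n → ℝ) (i : Fin n) (ω : SketchHash R n C)
    {ε : ℝ} (hε : 0 ≤ ε) (h : ε < sketchError x i ω) :
    2 * ∑ u, halfBall ε (rowNoise x i (ω u)) ≤ ∑ u, Real.sign (rowNoise x i (ω u)) := by
  have h1 := le_two_mul_sum_of_lt_sketchError hR x i ω h
  simp only [sign_eq_two_mul_halfBall hε, Finset.sum_add_distrib, Finset.sum_sub_distrib,
    ← Finset.mul_sum, Finset.sum_const, Finset.card_univ, Fintype.card_fin, nsmul_eq_mul, mul_one]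
  have h2 : ∑ u, {z : ℝ | ε < z}.indicator (fun _ => (1 : ℝ)) (rowNoise x i (ω u))
      = ∑ u, {ρ | ε < rowNoise x i ρ}.indicator (fun _ => (1 : ℝ)) (ω u) := rfl
  rw [h2]
  linarith

theorem two_mul_sum_halfBall_neg_le (hR : 0 < R) (x : Fin n → ℝ) (i : Fin n)
    (ω : SketchHash R n C) {ε : ℝ} (hε : 0 ≤ ε) (h : sketchError x i ω < -ε) :
    2 * ∑ u, halfBall ε (-rowNoise x i (ω u)) ≤ -∑ u, Real.sign (rowNoise x i (ω u)) := by
  have h1 := le_two_mul_sum_of_sketchError_lt hR x i ω h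
  rw [← Finset.sum_neg_distrib]
  simp only [← Real.sign_neg]
  simp only [sign_eq_two_mul_halfBall hε, Finset.sum_add_distrib, Finset.sum_sub_distrib,
    ← Finset.mul_sum, Finset.sum_const, Finset.card_univ, Fintype.card_fin, nsmul_eq_mul, mul_one]
  have h2 : ∑ u, {z : ℝ | ε < z}.indicator (fun _ => (1 : ℝ)) (-rowNoise x i (ω u))
      = ∑ u, {ρ | rowNoise x i ρ < -ε}.indicator (fun _ => (1 : ℝ)) (ω u) := by
    refine Finset.sum_congr rfl fun u _ => ?_
    simp only [Set.indicator, Set.mem_ofPred_eq, lt_neg (a := ε)]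
  rw [h2]
  linarith

/-- The rows give too few small errors at scale `ε`. -/
def sparseRows (x : Fin n → ℝ) (i : Fin n) (ε b : ℝ) : Set (SketchHash R n C) :=
  {ω | ∑ u, halfBall ε (rowNoise x i (ω u)) ≤ b} ∪
    {ω | ∑ u, halfBall ε (-rowNoise x i (ω u)) ≤ b}

/-- The expected count on each side is at least Rε/(64s), and the event asks for a quarter of
Rε/(64s). The exponent is linear in ε/s, so even the scale s/√R fails only with probability
exponentially small in √R. -/
theorem uprob_sparseRows_le [NeZero C] (hC2 : 2 ≤ C) (x : Fin n → ℝ)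
    (i : Fin n) (H : Finset (Fin n)) (hH : 2 * H.card ≤ C) {s ε : ℝ} (hε : 0 < ε)
    (hεs : ε ≤ s) (hx : ∑ j ∈ Hᶜ, x j ^ 2 ≤ C * s ^ 2) :
    uprob (sparseRows x i ε (R * (ε / (256 * s))) : Set (SketchHash R n C))
      ≤ 2 * Real.exp (-(R * (ε / (256 * s)))) := by
  have hp := le_uprob_abs_rowNoise_le hC2 x i H hH hε hεs hx
  have hν : ε / (256 * s) = ε / (32 * s) / 2 / 4 := by
    have hs : 0 < s := hε.trans_le hεs
    field_simp; norm_num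
  have h1 := uprob_sum_le_quarter_le (ι := Fin R) (Ω := Fin n → Fin C × ℤˣ)
    (fun ρ => halfBall ε (rowNoise x i ρ)) (fun _ => halfBall_nonneg _ _)
    (fun _ => halfBall_le_one _ _) (ν := ε / (32 * s) / 2)
    (by rw [(expect_halfBall_rowNoise hε.le x i).1]; linarith)
  have h2 := uprob_sum_le_quarter_le (ι := Fin R) (Ω := Fin n → Fin C × ℤˣ)
    (fun ρ => halfBall ε (-rowNoise x i ρ)) (fun _ => halfBall_nonneg _ _)
    (fun _ => halfBall_le_one _ _) (ν := ε / (32 * s) / 2)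
    (by rw [(expect_halfBall_rowNoise hε.le x i).2]; linarith)
  rw [Fintype.card_fin, ← hν] at h1 h2
  rw [two_mul]
  exact (uprob_union_le _ _).trans (add_le_add h1 h2)

/-- If no scale is sparse, the error is controlled by the sum of the signs of the row errors. -/
theorem sketchError_sq_le (hR : 0 < R) (x : Fin n → ℝ) (i : Fin n) (ω : SketchHash R n C)
    {s e : ℝ} (he : 0 < e) (hs : 0 < s) (hle : |sketchError x i ω| ≤ s)
    (hrows : ∀ j ∈ Finset.Icc 1 ⌊s / e⌋₊, ω ∉ sparseRows x i (j * e) (R * (j * e / (256 * s)))) :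
    sketchError x i ω ^ 2
      ≤ e ^ 2 + (256 * s / R) ^ 2 * (∑ u, Real.sign (rowNoise x i (ω u))) ^ 2 := by
  have hR' : (0 : ℝ) < R := Nat.cast_pos.2 hR
  set y := |sketchError x i ω| with hy
  set G := ∑ u, Real.sign (rowNoise x i (ω u)) with hG
  rw [← sq_abs (sketchError x i ω), ← hy]
  by_cases hye : y ≤ e
  · have : y ^ 2 ≤ e ^ 2 := pow_le_pow_left₀ (abs_nonneg _) hye 2
    have : 0 ≤ (256 * s / R) ^ 2 * G ^ 2 := by positivity
    linarith
  rw [not_le] at hye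
  -- Taking j = ⌈y/e⌉ - 1 ≥ 1 gives y ≤ (j + 1)e ≤ 2je: rounding to the grid costs a factor 2.
  obtain ⟨j, hj1, hjlt, hjle⟩ : ∃ j : ℕ, 1 ≤ j ∧ j * e < y ∧ y ≤ (j + 1) * e := by
    have hpos : 1 < ⌈y / e⌉₊ := by
      rw [Nat.lt_ceil, Nat.cast_one, one_lt_div he]; exact hye
    refine ⟨⌈y / e⌉₊ - 1, by omega, ?_, ?_⟩
    · rw [← lt_div_iff₀ he, ← Nat.lt_ceil]; omega
    · rw [← div_le_iff₀ he]
      refine (Nat.le_ceil _).trans (le_of_eq ?_)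
      rw [Nat.cast_sub hpos.le]; simp
  have hj1' : (1 : ℝ) ≤ j := by exact_mod_cast hj1
  have hjJ : j ∈ Finset.Icc 1 ⌊s / e⌋₊ := by
    rw [Finset.mem_Icc]
    refine ⟨hj1, Nat.le_floor ?_⟩
    rw [le_div_iff₀ he]; linarith
  have hn := hrows j hjJ
  simp only [sparseRows, Set.mem_union, Set.mem_ofPred_eq, not_or, not_le] at hn
  have hGle : 2 * (R * (j * e / (256 * s))) ≤ |G| := by
    rcases lt_abs.1 hjlt with h | h
    · have h1 := two_mul_sum_halfBall_le hR x i ω (by positivity) h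
      have h2 := le_abs_self G
      linarith [hn.1]
    · have h1 := two_mul_sum_halfBall_neg_le hR x i ω
        (show 0 ≤ (j : ℝ) * e by positivity) (by linarith)
      have h2 := neg_le_abs G
      linarith [hn.2]
  have hyG : y ≤ 256 * s / R * |G| := by
    have h1 : y ≤ 2 * (j * e) := by nlinarith
    have h2 := mul_le_mul_of_nonneg_left hGle (show 0 ≤ 256 * s / R by positivity)
    have h3 : 256 * s / R * (2 * (R * (j * e / (256 * s)))) = 2 * (j * e) := by
      field_simp
    linarith
  have h4 : y ^ 2 ≤ (256 * s / R * |G|) ^ 2 := pow_le_pow_left₀ (abs_nonneg _) hyG 2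
  rw [mul_pow, sq_abs G] at h4
  linarith [sq_nonneg e]

/-- The signs of the row errors of different coordinates are almost uncorrelated. -/
theorem uprob_sum_sign_sq_le [NeZero C] (hR : 0 < R) (x : Fin n → ℝ) (S : Finset (Fin n))
    (hSne : S.Nonempty) (hS : S.card ≤ C) :
    uprob {ω : SketchHash R n C |
        2 * S.card * R < ∑ i ∈ S, (∑ u, Real.sign (rowNoise x i (ω u))) ^ 2} ≤ 4 / S.card := by
  have hC : (0 : ℝ) < C := Nat.cast_pos.2 (NeZero.pos C)
  have hR' : (0 : ℝ) < R := Nat.cast_pos.2 hR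
  have hm : (0 : ℝ) < S.card := Nat.cast_pos.2 hSne.card_pos
  have hS' : (S.card : ℝ) ≤ C := by exact_mod_cast hS
  set ζ : Fin n → (Fin n → Fin C × ℤˣ) → ℝ := fun i ρ => Real.sign (rowNoise x i ρ) with hζ
  -- The diagonal gives at most |S|, and correlations at most 1/C add at most |S|²/C² ≤ |S|.
  have hV : ∑ i ∈ S, ∑ j ∈ S, (𝔼 a, ζ i a * ζ j a) ^ 2 ≤ 2 * S.card := by
    have hpair : ∀ i ∈ S, ∀ j ∈ S, (𝔼 a, ζ i a * ζ j a) ^ 2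
        ≤ (if i = j then 1 else 0) + (1 / (C : ℝ)) ^ 2 := by
      intro i _ j _
      rw [← sq_abs]
      by_cases hij : i = j
      · rw [if_pos hij]
        have h1 : |𝔼 a, ζ i a * ζ j a| ≤ 1 := by
          refine (Finset.abs_expect_le _ _).trans ?_
          rw [← Fintype.expect_const (ι := Fin n → Fin C × ℤˣ) (1 : ℝ)]
          refine Finset.expect_le_expect fun ρ _ => ?_
          rw [abs_mul]
          exact mul_le_one₀ (abs_sign_le_one _) (abs_nonneg _) (abs_sign_le_one _)
        have h2 := pow_le_one₀ (n := 2) (abs_nonneg _) h1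
        linarith [sq_nonneg (1 / (C : ℝ))]
      · rw [if_neg hij, zero_add]
        exact pow_le_pow_left₀ (abs_nonneg _) (abs_expect_sign_mul_sign_le x hij) 2
    refine (Finset.sum_le_sum fun i hi => Finset.sum_le_sum fun j hj => hpair i hi j hj).trans ?_
    have hinner : ∀ i ∈ S, ∑ j ∈ S, ((if i = j then 1 else 0) + (1 / (C : ℝ)) ^ 2) ≤ 2 := by
      intro i hi
      rw [Finset.sum_add_distrib, Finset.sum_ite_eq, if_pos hi, Finset.sum_const, nsmul_eq_mul]
      have h1 : (S.card : ℝ) * (1 / C) ^ 2 ≤ 1 := by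
        rw [div_pow, one_pow, mul_one_div, div_le_one (by positivity)]
        have : (1 : ℝ) ≤ C := Nat.one_le_cast.2 NeZero.one_le
        nlinarith
      linarith
    refine (Finset.sum_le_card_nsmul _ _ _ hinner).trans (le_of_eq ?_)
    rw [nsmul_eq_mul, mul_comm]
  have hQ := expect_offDiagonal_sq_le R S ζ (expect_sign_rowNoise x)
  have hdiag : ∀ ω : SketchHash R n C, ∑ i ∈ S, (∑ u, ζ i (ω u)) ^ 2
      ≤ S.card * R + offDiagonal S ζ ω := by
    intro ω
    rw [offDiagonal, Finset.sum_sub_distrib]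
    have : ∑ i ∈ S, ∑ u, ζ i (ω u) ^ 2 ≤ S.card * R := by
      rw [← nsmul_eq_mul]
      refine Finset.sum_le_card_nsmul _ _ _ fun i _ => ?_
      refine (Finset.sum_le_card_nsmul _ _ 1 fun u _ => ?_).trans (le_of_eq (by simp))
      rw [← sq_abs]
      exact pow_le_one₀ (abs_nonneg _) (abs_sign_le_one _)
    linarith
  refine (uprob_le_div (f := fun ω => offDiagonal S ζ ω ^ 2) (pow_pos (mul_pos hm hR') 2)
    (fun _ => sq_nonneg _) fun ω hω => ?_).trans ?_
  · have h1 : 2 * S.card * R < ∑ i ∈ S, (∑ u, ζ i (ω u)) ^ 2 := hω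
    exact pow_le_pow_left₀ (by positivity) (by linarith [hdiag ω]) 2
  · rw [div_le_iff₀ (by positivity)]
    have h1 := mul_le_mul_of_nonneg_left hV (show 0 ≤ 2 * (R : ℝ) ^ 2 by positivity)
    have h2 : 4 / (S.card : ℝ) * (S.card * R) ^ 2 = 2 * R ^ 2 * (2 * S.card) := by
      field_simp; norm_num
    linarith

/-- The set estimate when the number of rows is large. -/
theorem uprob_set_error_many_rows [NeZero C] (hC2 : 2 ≤ C) (hR : 0 < R) (x : Fin n → ℝ)
    (S H : Finset (Fin n)) (hSne : S.Nonempty) (hS : S.card ≤ C) (hH : 2 * H.card ≤ C)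
    {s B t : ℝ} (hs : 0 < s)
    (hx : ∑ j ∈ Hᶜ, x j ^ 2 ≤ C * s ^ 2) (hst : 262144 * s ^ 2 ≤ t * B ^ 2) :
    uprob {ω : SketchHash R n C | t * S.card * (1 / R) * B ^ 2 < ∑ i ∈ S, sketchError x i ω ^ 2}
      ≤ S.card * (2 * Real.exp (-(R / 2048)) + R * (2 * Real.exp (-√R))) + 4 / S.card := by
  have hR' : (0 : ℝ) < R := Nat.cast_pos.2 hR
  have hR1 : (1 : ℝ) ≤ R := by exact_mod_cast hR
  have hm : (0 : ℝ) < S.card := Nat.cast_pos.2 hSne.card_pos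
  have hsR : 0 < √(R : ℝ) := Real.sqrt_pos.2 hR'
  -- This makes the sparsity threshold at level j equal to j√R.
  set e := 256 * s / √R with he
  have he0 : 0 < e := by positivity
  have he2 : e ^ 2 = 65536 * s ^ 2 / R := by
    rw [he, div_pow, Real.sq_sqrt hR'.le]; ring
  set J := ⌊s / e⌋₊ with hJ
  have hJR : (J : ℝ) ≤ R := by
    refine (Nat.floor_le (by positivity)).trans ?_
    rw [he]
    have h1 : s / (256 * s / √R) = √R / 256 := by field_simp
    have h2 : √(R : ℝ) ≤ R := Real.sqrt_le_iff.2 ⟨hR'.le, by nlinarith⟩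
    rw [h1]; linarith
  have hJs : ∀ j ∈ Finset.Icc 1 J, 0 < (j : ℝ) * e ∧ (j : ℝ) * e ≤ s := by
    intro j hj
    rw [Finset.mem_Icc] at hj
    have hj1 : (1 : ℝ) ≤ j := by exact_mod_cast hj.1
    have hjJ : (j : ℝ) ≤ J := by exact_mod_cast hj.2
    refine ⟨by positivity, ?_⟩
    rw [← le_div_iff₀ he0]
    exact hjJ.trans (Nat.floor_le (by positivity))
  have hsparse : ∀ i ∈ S, ∀ j ∈ Finset.Icc 1 J,
      uprob (sparseRows x i (j * e) (R * (j * e / (256 * s))) : Set (SketchHash R n C))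
        ≤ 2 * Real.exp (-√R) := by
    intro i _ j hj
    obtain ⟨h1, h2⟩ := hJs j hj
    refine (uprob_sparseRows_le hC2 x i H hH h1 h2 hx).trans ?_
    refine mul_le_mul_of_nonneg_left (Real.exp_le_exp.2 (neg_le_neg ?_)) (by norm_num)
    have hj1 : (1 : ℝ) ≤ j := by exact_mod_cast (Finset.mem_Icc.1 hj).1
    have h3 : (R : ℝ) * (j * e / (256 * s)) = j * √R := by
      rw [he]
      field_simp
      rw [Real.sq_sqrt hR'.le]
    rw [h3]
    exact le_mul_of_one_le_left hsR.le hj1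
  let bad : Fin n → Set (SketchHash R n C) := fun i =>
    {ω | s < |sketchError x i ω|} ∪
      ⋃ j ∈ Finset.Icc 1 J, sparseRows x i (j * e) (R * (j * e / (256 * s)))
  have hbad : ∀ i ∈ S, uprob (bad i)
      ≤ 2 * Real.exp (-(R / 2048)) + R * (2 * Real.exp (-√R)) := by
    intro i hi
    refine (uprob_union_le _ _).trans (add_le_add ?_ ?_)
    · refine (uprob_lt_abs_sketchError_le_exp hC2 hR x i H hH hs le_rfl hx).trans (le_of_eq ?_)
      congr 3
      field_simp
      norm_num
    · refine (uprob_biUnion_le_card_mul _ _ (hsparse i hi)).trans ?_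
      rw [Nat.card_Icc, Nat.add_sub_cancel]
      gcongr
  refine (uprob_mono fun ω hω => ?_).trans ((uprob_union_le _ _).trans
    (add_le_add (uprob_biUnion_le_card_mul S bad hbad) (uprob_sum_sign_sq_le hR x S hSne hS)))
  by_contra hcon
  simp only [Set.mem_union, Set.mem_iUnion, not_or, not_exists, bad, Set.mem_ofPred_eq,
    not_lt] at hcon
  obtain ⟨h1, h2⟩ := hcon
  have h3 : ∑ i ∈ S, sketchError x i ω ^ 2 ≤ S.card * e ^ 2
      + (256 * s / R) ^ 2 * ∑ i ∈ S, (∑ u, Real.sign (rowNoise x i (ω u))) ^ 2 := by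
    refine (Finset.sum_le_sum fun i hi =>
      sketchError_sq_le hR x i ω he0 hs (h1 i hi).1 (h1 i hi).2).trans (le_of_eq ?_)
    rw [Finset.sum_add_distrib, Finset.sum_const, nsmul_eq_mul, Finset.mul_sum]
  have h4 := mul_le_mul_of_nonneg_left h2 (show 0 ≤ (256 * s / R) ^ 2 by positivity)
  -- 196608 = 3·256²: one share from `e ^ 2`, two from the sum of signs.
  have h5 : S.card * e ^ 2 + (256 * s / R) ^ 2 * (2 * S.card * R)
      = S.card * (1 / R) * (196608 * s ^ 2) := by
    rw [he2]; field_simp; norm_num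
  have h6 : S.card * (1 / R) * (196608 * s ^ 2) ≤ S.card * (1 / (R : ℝ)) * (t * B ^ 2) := by
    refine mul_le_mul_of_nonneg_left ?_ (by positivity)
    linarith [sq_nonneg s]
  have h7 : t * S.card * (1 / R) * B ^ 2 < ∑ i ∈ S, sketchError x i ω ^ 2 := hω
  have h8 : t * S.card * (1 / R) * B ^ 2 = S.card * (1 / (R : ℝ)) * (t * B ^ 2) := by ring
  linarith

end ManyRows

/-! ### Tail vector, choice of constants and assembly. -/

section Assembly

variable {R n C : ℕ}

theorem sketchMeasure_real_eq_uprob (s : Set (SketchHash R n C)) :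
    (sketchMeasure R n C).real s = uprob s := by
  classical
  rw [uprob, Fintype.expect_eq_sum_div_card, MeasureTheory.Measure.real, sketchMeasure,
    ProbabilityTheory.uniformOn_univ, MeasureTheory.Measure.count_apply_finite _ s.toFinite,
    ENNReal.toReal_div]
  congr 1
  rw [ENNReal.toReal_natCast, Finset.card_eq_sum_ones, Nat.cast_sum,
    ← Finset.sum_indicator_subset (fun _ => ((1 : ℕ) : ℝ)) (Finset.subset_univ _)]
  simp

theorem magnitudeRank_lt_of_precedes (x : Fin n → ℝ) {i j : Fin n}
    (h : |x j| < |x i| ∨ (|x i| = |x j| ∧ i < j)) : magnitudeRank x i < magnitudeRank x j := by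
  refine Set.ncard_lt_ncard ⟨?_, fun hsub => ?_⟩ (Set.toFinite _)
  · intro l hl
    simp only [Set.mem_ofPred_eq] at hl ⊢
    grind
  · have := hsub (show i ∈ {l | |x j| < |x l| ∨ (|x l| = |x j| ∧ l < j)} from h)
    simp at this

theorem magnitudeRank_injective (x : Fin n → ℝ) : Function.Injective (magnitudeRank x) := by
  intro i j hij
  by_contra hne
  rcases lt_trichotomy |x i| |x j| with h | h | h
  · exact (magnitudeRank_lt_of_precedes x (Or.inl h)).ne' hij
  · rcases lt_or_gt_of_ne hne with h' | h'
    · exact (magnitudeRank_lt_of_precedes x (Or.inr ⟨h, h'⟩)).ne hij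
    · exact (magnitudeRank_lt_of_precedes x (Or.inr ⟨h.symm, h'⟩)).ne' hij
  · exact (magnitudeRank_lt_of_precedes x (Or.inl h)).ne hij

theorem card_filter_magnitudeRank_lt_le (x : Fin n → ℝ) (k : ℕ) :
    (Finset.univ.filter fun i => magnitudeRank x i < k).card ≤ k := by
  conv_rhs => rw [← Finset.card_range k]
  exact Finset.card_le_card_of_injOn (magnitudeRank x)
    (fun i hi => by simpa using hi) (magnitudeRank_injective x).injOn

theorem sum_tailVec_sq (x : Fin n → ℝ) (k : ℕ) :
    ∑ i, tailVec x k i ^ 2 = ∑ i ∈ (Finset.univ.filter fun i => magnitudeRank x i < k)ᶜ, x i ^ 2 := by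
  rw [Finset.compl_filter, Finset.sum_filter]
  refine Finset.sum_congr rfl fun i _ => ?_
  unfold tailVec
  split_ifs <;> simp

/-- Finitely many values leave room to raise the threshold strictly. This supplies a positive noise
level even when the tail of x is zero. -/
theorem exists_gt_superlevel_subset {Ω : Type*} [Finite Ω] (f : Ω → ℝ) (θ : ℝ) :
    ∃ θ' > θ, {ω | θ < f ω} ⊆ {ω | θ' < f ω} := by
  have h : ∀ᶠ θ' in nhdsWithin θ (Set.Ioi θ), ∀ ω, θ < f ω → θ' < f ω := by
    rw [Filter.eventually_all]
    intro ω
    by_cases hω : θ < f ω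
    · filter_upwards [Ioo_mem_nhdsGT hω] with θ' hθ' _ using hθ'.2
    · exact Filter.Eventually.of_forall fun _ h => absurd h hω
  obtain ⟨θ', h1, h2⟩ := (h.and self_mem_nhdsWithin).exists
  exact ⟨θ', h2, fun ω hω => h1 ω hω⟩

theorem mul_exp_neg_div_le {y a : ℝ} (hy : 0 < y) (ha : 0 < a) :
    y * Real.exp (-(y / a)) ≤ 2 * a ^ 2 / y := by
  have h := Real.pow_div_factorial_le_exp (y / a) (by positivity) 2
  rw [Real.exp_neg, ← div_eq_mul_inv, div_le_div_iff₀ (Real.exp_pos _) hy]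
  have h2 : y * y = 2 * a ^ 2 * ((y / a) ^ 2 / ((2 : ℕ).factorial : ℝ)) := by
    simp only [Nat.factorial]
    push_cast
    field_simp
  rw [h2]
  gcongr

/-- The bounds on q and log k give (2√q)^R ≤ exp(-2AR) ≤ k⁻², which pays for the union bound over S.
The condition R⁴ ≤ m gives R³/m ≤ m^(-1/4). -/
theorem few_rows_bound_le {A t : ℝ} {m k R : ℕ} {q : ℝ} (hm : 0 < m) (hmk : m ≤ k)
    (hk : Real.log k ≤ A * R) (hq : 4 * q ≤ Real.exp (-(4 * A)))
    (hRm : R ^ 4 ≤ m) :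
    m * (2 * (2 * √q) ^ R) + 84 / t ^ 2 * ((R : ℝ) ^ 3 / m)
      ≤ (2 + 84 / t ^ 2) * (1 / (m : ℝ) ^ ((1 : ℝ) / 14)) := by
  have hm0 : (0 : ℝ) < m := Nat.cast_pos.2 hm
  have hm1 : (1 : ℝ) ≤ m := Nat.one_le_cast.2 hm
  have hmk' : (m : ℝ) ≤ k := Nat.cast_le.2 hmk
  have hk0 : (0 : ℝ) < k := by linarith
  set z := (m : ℝ) ^ ((1 : ℝ) / 14) with hz
  have hz0 : 0 < z := Real.rpow_pos_of_pos hm0 _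
  have h1 : m * (2 * (2 * √q) ^ R) ≤ 2 * (1 / z) := by
    have h2 : 2 * √q ≤ Real.exp (-(2 * A)) := by
      rw [show (2 : ℝ) * √q = √(4 * q) by
        rw [Real.sqrt_mul (by norm_num), show (4 : ℝ) = 2 ^ 2 by norm_num,
          Real.sqrt_sq (by norm_num)]]
      refine Real.sqrt_le_iff.2 ⟨(Real.exp_pos _).le, hq.trans (le_of_eq ?_)⟩
      rw [← Real.exp_nat_mul]; push_cast; ring_nf
    have h3 : (2 * √q) ^ R ≤ ((k : ℝ) ^ 2)⁻¹ := by
      refine (pow_le_pow_left₀ (by positivity) h2 R).trans ?_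
      rw [← Real.exp_nat_mul, ← Real.exp_log hk0, ← Real.exp_nat_mul, ← Real.exp_neg]
      refine Real.exp_le_exp.2 ?_
      push_cast; linarith
    have h4 : z ≤ m := by
      rw [hz]
      exact (Real.rpow_le_rpow_of_exponent_le hm1 (by norm_num)).trans_eq (Real.rpow_one _)
    have h5 : ((k : ℝ) ^ 2)⁻¹ ≤ ((m : ℝ) ^ 2)⁻¹ := by gcongr
    calc m * (2 * (2 * √q) ^ R) ≤ m * (2 * ((m : ℝ) ^ 2)⁻¹) := by gcongr; exact h3.trans h5
      _ = 2 * (1 / m) := by field_simp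
      _ ≤ 2 * (1 / z) := by gcongr
  have h6 : (R : ℝ) ^ 3 / m ≤ 1 / z := by
    set r := (m : ℝ) ^ ((1 : ℝ) / 4) with hr
    have hr0 : 0 < r := Real.rpow_pos_of_pos hm0 _
    have hr4 : r ^ 4 = m := by
      rw [hr, ← Real.rpow_natCast, ← Real.rpow_mul hm0.le]; norm_num
    have hRr : (R : ℝ) ≤ r := by
      refine le_of_pow_le_pow_left₀ (n := 4) (by norm_num) hr0.le ?_
      rw [hr4]; exact_mod_cast hRm
    have hzr : z ≤ r := Real.rpow_le_rpow_of_exponent_le hm1 (by norm_num)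
    rw [div_le_div_iff₀ hm0 hz0, one_mul, ← hr4]
    calc (R : ℝ) ^ 3 * z ≤ r ^ 3 * r := by gcongr
      _ = r ^ 4 := by ring
  have h7 := mul_le_mul_of_nonneg_left h6 (show 0 ≤ 84 / t ^ 2 by positivity)
  rw [add_mul]
  exact add_le_add h1 h7

theorem many_rows_bound_le {m R : ℕ} (hm : 0 < m) (hR : 0 < R) (hRm : m ≤ R ^ 4) :
    m * (2 * Real.exp (-(R / 2048)) + R * (2 * Real.exp (-√R))) + 4 / m
      ≤ (4 * 2048 ^ 18 * (Nat.factorial 18 : ℝ) + 4) * (1 / (m : ℝ) ^ ((1 : ℝ) / 14)) := by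
  have hm0 : (0 : ℝ) < m := Nat.cast_pos.2 hm
  have hm1 : (1 : ℝ) ≤ m := Nat.one_le_cast.2 hm
  have hR0 : (0 : ℝ) < R := Nat.cast_pos.2 hR
  have hR1 : (1 : ℝ) ≤ R := Nat.one_le_cast.2 hR
  set z := (m : ℝ) ^ ((1 : ℝ) / 14) with hz
  have hz0 : 0 < z := Real.rpow_pos_of_pos hm0 _
  have hzm : z ≤ m := by
    rw [hz]
    exact (Real.rpow_le_rpow_of_exponent_le hm1 (by norm_num)).trans_eq (Real.rpow_one _)
  have hmR : (m : ℝ) ≤ R ^ 4 := by exact_mod_cast hRm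
  set y := √(R : ℝ) with hy
  have hy0 : 0 ≤ y := Real.sqrt_nonneg _
  have hy2 : y ^ 2 = R := Real.sq_sqrt hR0.le
  have hyR : y ≤ R := Real.sqrt_le_iff.2 ⟨hR0.le, by nlinarith⟩
  set E := Real.exp (-(y / 2048)) with hE
  have hE0 : 0 < E := Real.exp_pos _
  have h1 : Real.exp (-((R : ℝ) / 2048)) ≤ E := Real.exp_le_exp.2 (by linarith)
  have h2 : Real.exp (-y) ≤ E := Real.exp_le_exp.2 (by linarith)
  have h3 : 2 * Real.exp (-((R : ℝ) / 2048)) + R * (2 * Real.exp (-y)) ≤ 4 * R * E := by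
    have h4 : 2 * Real.exp (-((R : ℝ) / 2048)) ≤ 2 * (R * E) := by
      have := le_mul_of_one_le_left hE0.le hR1
      linarith
    have h5 : R * (2 * Real.exp (-y)) ≤ R * (2 * E) := by gcongr
    linarith
  -- Nine powers of R are needed: four for m, four for m^(1/14) and one for the number of scales. As
  -- R = y², the Taylor term of order 18 supplies them.
  have h6 : (R : ℝ) ^ 9 * E ≤ 2048 ^ 18 * (Nat.factorial 18 : ℝ) := by
    have h7 := Real.pow_div_factorial_le_exp (y / 2048) (by positivity) 18
    rw [hE, Real.exp_neg, ← div_eq_mul_inv, div_le_iff₀ (Real.exp_pos _)]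
    have hf : (0 : ℝ) < (Nat.factorial 18 : ℝ) := Nat.cast_pos.2 (Nat.factorial_pos _)
    have h8 := mul_le_mul_of_nonneg_left h7
      (show 0 ≤ 2048 ^ 18 * (Nat.factorial 18 : ℝ) by positivity)
    refine le_trans (le_of_eq ?_) h8
    rw [← hy2, div_pow, ← pow_mul]
    field_simp
  have h9 : m * (2 * Real.exp (-((R : ℝ) / 2048)) + R * (2 * Real.exp (-y)))
      ≤ 4 * 2048 ^ 18 * (Nat.factorial 18 : ℝ) * (1 / z) := by
    rw [mul_one_div, le_div_iff₀ hz0]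
    calc m * (2 * Real.exp (-((R : ℝ) / 2048)) + R * (2 * Real.exp (-y))) * z
        ≤ R ^ 4 * (4 * R * E) * R ^ 4 := by
          gcongr
          exact hzm.trans hmR
      _ = 4 * (R ^ 9 * E) := by ring
      _ ≤ 4 * (2048 ^ 18 * (Nat.factorial 18 : ℝ)) := by gcongr
      _ = _ := by ring
  have h10 : 4 / (m : ℝ) ≤ 4 * (1 / z) := by
    rw [mul_one_div]; gcongr
  rw [add_mul]
  exact add_le_add h9 h10

/-- The set estimate for a general set `H` of large coordinates and noise level `B`. -/
theorem exists_uprob_set_error_le (A : ℝ) (hA : 0 < A) (t : ℝ) (ht : 0 < t) :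
    ∃ c₀ K : ℝ, ∀ c : ℝ, c₀ ≤ c → ∀ n k R C : ℕ, 1 ≤ k → 1 ≤ R →
      (C : ℝ) = c * (k : ℝ) → Real.log (k : ℝ) ≤ A * (R : ℝ) →
      ∀ (x : Fin n → ℝ) (S H : Finset (Fin n)) (B : ℝ), S.Nonempty → S.card ≤ k → H.card ≤ k →
        0 < B → ∑ j ∈ Hᶜ, x j ^ 2 ≤ k * B ^ 2 →
        uprob {ω : SketchHash R n C |
            t * S.card * (1 / R) * B ^ 2 < ∑ i ∈ S, sketchError x i ω ^ 2} ≤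
          K * (1 / (S.card : ℝ) ^ ((1 : ℝ) / 14)) := by
  -- The first bound meets the constants of both regimes, the second gives 2s ≤ B.
  set τ := min (t / 262144) (1 / 4) with hτ
  have hτ0 : 0 < τ := lt_min (by positivity) (by norm_num)
  have hτt : τ ≤ t / 262144 := min_le_left _ _
  have hτ4 : τ ≤ 1 / 4 := min_le_right _ _
  -- The summands respectively make q = 2/c₀ satisfy 4q ≤ exp(-4A), bring the light energy below C
  -- s², and ensure C ≥ 4k.
  set c₀ := 8 * Real.exp (4 * A) + 1 / τ + 4 with hc₀
  have hc₀4 : 4 ≤ c₀ := by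
    have : 0 ≤ 8 * Real.exp (4 * A) + 1 / τ := by positivity
    linarith
  have hc₀τ : 1 / τ ≤ c₀ := by
    have : 0 ≤ 8 * Real.exp (4 * A) := by positivity
    linarith
  have hc₀A : 8 * Real.exp (4 * A) ≤ c₀ := by
    have : 0 ≤ 1 / τ := by positivity
    linarith
  -- 2²⁶ = 8·2·2048², so that R ≥ R₀ gives 8R exp(-R/2048) ≤ t.
  set R₀ := 2 ^ 26 / t with hR₀
  set K₁ := 2 + 84 / t ^ 2 with hK₁
  set K₂ := 4 * 2048 ^ 18 * (Nat.factorial 18 : ℝ) + 4 with hK₂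
  have hK₁0 : 0 ≤ K₁ := by positivity
  have hK₂0 : 0 ≤ K₂ := by positivity
  refine ⟨c₀, Real.exp (A * R₀) + K₁ + K₂, ?_⟩
  intro c hc n k R C hk hR hCk hlog x S H B hSne hSk hHk hB hx
  have hk0 : (0 : ℝ) < k := by exact_mod_cast hk
  have hR0 : (0 : ℝ) < R := by exact_mod_cast hR
  have hm0 : (0 : ℝ) < S.card := Nat.cast_pos.2 hSne.card_pos
  have hm1 : (1 : ℝ) ≤ S.card := Nat.one_le_cast.2 hSne.card_pos
  have hSk' : (S.card : ℝ) ≤ k := by exact_mod_cast hSk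
  have hHk' : (H.card : ℝ) ≤ k := by exact_mod_cast hHk
  have hc4 : 4 ≤ c := hc₀4.trans hc
  have hC4 : 4 * k ≤ C := by
    have : (4 : ℝ) * k ≤ C := by rw [hCk]; gcongr
    exact_mod_cast this
  have hC2 : 2 ≤ C := by omega
  have hC0 : (0 : ℝ) < C := by exact_mod_cast (by omega : 0 < C)
  have : NeZero C := ⟨by omega⟩
  have hz : 0 ≤ 1 / (S.card : ℝ) ^ ((1 : ℝ) / 14) := by positivity
  -- Here |S| ≤ k ≤ exp(A R₀), and K makes the right-hand side at least 1.
  by_cases hRR : (R : ℝ) < R₀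
  · refine (uprob_le_one _).trans ?_
    have h1 : (S.card : ℝ) ^ ((1 : ℝ) / 14) ≤ Real.exp (A * R₀) := by
      calc (S.card : ℝ) ^ ((1 : ℝ) / 14) ≤ (S.card : ℝ) ^ (1 : ℝ) :=
            Real.rpow_le_rpow_of_exponent_le hm1 (by norm_num)
        _ = S.card := Real.rpow_one _
        _ ≤ k := hSk'
        _ = Real.exp (Real.log k) := (Real.exp_log hk0).symm
        _ ≤ Real.exp (A * R₀) := Real.exp_le_exp.2 (hlog.trans (by gcongr))
    rw [mul_one_div, one_le_div (Real.rpow_pos_of_pos hm0 _)]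
    linarith
  rw [not_lt] at hRR
  set s := B * √τ with hs
  have hs0 : 0 < s := mul_pos hB (Real.sqrt_pos.2 hτ0)
  have hs2 : s ^ 2 = τ * B ^ 2 := by rw [hs, mul_pow, Real.sq_sqrt hτ0.le]; ring
  have hxs : ∑ j ∈ Hᶜ, x j ^ 2 ≤ C * s ^ 2 := by
    refine hx.trans ?_
    rw [hCk, hs2]
    have h1 : 1 ≤ c * τ := by
      have := (div_le_iff₀ hτ0).1 (hc₀τ.trans hc)
      linarith
    calc k * B ^ 2 = 1 * (k * B ^ 2) := (one_mul _).symm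
      _ ≤ c * τ * (k * B ^ 2) := by gcongr
      _ = c * k * (τ * B ^ 2) := by ring
  have hst : 262144 * s ^ 2 ≤ t * B ^ 2 := by
    rw [hs2, ← mul_assoc]
    gcongr
    linarith
  have hH2 : 2 * H.card ≤ C := by omega
  have hSC : S.card ≤ C := by omega
  rcases le_total (R ^ 4) S.card with hRm | hRm
  · have hsB : 2 * s ≤ B := by
      have : √τ ≤ 1 / 2 := Real.sqrt_le_iff.2 ⟨by norm_num, by linarith⟩
      rw [hs]; nlinarith
    have hRt : 8 * R * Real.exp (-((R : ℝ) / 2048)) ≤ t := by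
      have h1 := mul_exp_neg_div_le hR0 (show (0 : ℝ) < 2048 by norm_num)
      have h2 : 2 * (2048 : ℝ) ^ 2 / R ≤ t / 8 := by
        rw [div_le_iff₀ hR0]
        have := (div_le_iff₀ ht).1 hRR
        norm_num at this ⊢
        linarith
      linarith
    have hq : H.card / C + (∑ j ∈ Hᶜ, x j ^ 2) / (C * B ^ 2) ≤ 2 / c₀ := by
      have h1 : (k : ℝ) / C ≤ 1 / c₀ := by
        rw [div_le_div_iff₀ hC0 (by linarith), one_mul, hCk, mul_comm]
        gcongr
      have h2 : (H.card : ℝ) / C ≤ k / C := by gcongr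
      have h3 : (∑ j ∈ Hᶜ, x j ^ 2) / (C * B ^ 2) ≤ k / C := by
        rw [div_le_div_iff₀ (by positivity) hC0]
        calc (∑ j ∈ Hᶜ, x j ^ 2) * C ≤ k * B ^ 2 * C := by gcongr
          _ = k * (C * B ^ 2) := by ring
      have h4 : 2 / c₀ = 1 / c₀ + 1 / c₀ := by ring
      linarith
    have hq4 : 4 * (2 / c₀) ≤ Real.exp (-(4 * A)) := by
      rw [Real.exp_neg, ← one_div, ← mul_div_assoc, div_le_div_iff₀ (by linarith) (Real.exp_pos _)]
      linarith
    refine (uprob_set_error_few_rows hC2 hR x S H hSne hSC hH2 hs0 ht hsB hxs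
      (by linarith [sq_nonneg s]) hRt (q := 2 / c₀) (by positivity)
      (by rw [div_le_iff₀ (by linarith)]; linarith) hq).trans ?_
    refine (few_rows_bound_le hSne.card_pos hSk hlog hq4 hRm).trans ?_
    refine mul_le_mul_of_nonneg_right ?_ hz
    linarith [Real.exp_pos (A * R₀)]
  · refine (uprob_set_error_many_rows hC2 hR x S H hSne hSC hH2 hs0 hxs hst).trans ?_
    refine (many_rows_bound_le hSne.card_pos hR hRm).trans ?_
    refine mul_le_mul_of_nonneg_right ?_ hz
    linarith [Real.exp_pos (A * R₀)]

end Assembly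

theorem mainTheorem6 (A : ℝ) (hA : 0 < A) (t : ℝ) (ht : 0 < t) :
    ∃ c₀ K : ℝ, ∀ c : ℝ, c₀ ≤ c → ∀ n k R C : ℕ, 1 ≤ k → 1 ≤ R →
      (C : ℝ) = c * (k : ℝ) → Real.log (k : ℝ) ≤ A * (R : ℝ) →
      ∀ (x : Fin n → ℝ) (S : Finset (Fin n)), S.Nonempty → S.card ≤ k →
        (sketchMeasure R n C).real
            {ω | t * (S.card : ℝ) * (1 / (R : ℝ)) * ((∑ i, tailVec x k i ^ 2) / (k : ℝ)) <
              ∑ i ∈ S, (sketchEstimate ω x i - x i) ^ 2} ≤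
          K * (1 / (S.card : ℝ) ^ ((1 : ℝ) / 14)) := by
  obtain ⟨c₀, K, h⟩ := exists_uprob_set_error_le A hA t ht
  refine ⟨c₀, K, ?_⟩
  intro c hc n k R C hk hR hCk hlog x S hSne hSk
  have hk0 : (0 : ℝ) < k := by exact_mod_cast hk
  have hR0 : (0 : ℝ) < R := by exact_mod_cast hR
  have hm0 : (0 : ℝ) < S.card := Nat.cast_pos.2 hSne.card_pos
  set a := t * (S.card : ℝ) * (1 / (R : ℝ)) with ha
  have ha0 : 0 < a := by positivity
  set b := (∑ i, tailVec x k i ^ 2) / (k : ℝ) with hb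
  have hb0 : 0 ≤ b := div_nonneg (Finset.sum_nonneg fun _ _ => sq_nonneg _) hk0.le
  obtain ⟨θ, hθ, hsub⟩ := exists_gt_superlevel_subset
    (fun ω : SketchHash R n C => ∑ i ∈ S, (sketchEstimate ω x i - x i) ^ 2) (a * b)
  have hbθ : b < θ / a := by rw [lt_div_iff₀ ha0, mul_comm]; exact hθ
  have hB2 : √(θ / a) ^ 2 = θ / a := Real.sq_sqrt (hb0.trans hbθ.le)
  rw [sketchMeasure_real_eq_uprob]
  refine (uprob_mono hsub).trans ?_
  -- The noise level √(θ/a) makes the threshold of the general estimate exactly θ.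
  have hmain := h c hc n k R C hk hR hCk hlog x S
    (Finset.univ.filter fun i => magnitudeRank x i < k) √(θ / a) hSne hSk
    (card_filter_magnitudeRank_lt_le x k) (Real.sqrt_pos.2 (hb0.trans_lt hbθ)) (by
      rw [hB2, ← sum_tailVec_sq]
      have := (div_lt_iff₀ hk0).1 hbθ
      linarith)
  rw [hB2, ← ha, mul_div_cancel₀ _ ha0.ne'] at hmain
  exact hmain
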